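/- **Notation.** For $\theta>0$ and a real random variable $X$ put $$\|X\|_{\psi_\theta}:=\inf\{c>0:\ \mathbb E\exp(|X|^\theta/c^\theta)\le 2\}\in[0,\infty].$$ For $L\ge 0$ let $\Psi_{\theta,L}:[0,\infty)\to[0,\infty)$ be the inverse of the function $\Psi_{\theta,L}^{-1}(t)=\sqrt{\log(1+t)}+L(\log(1+t))^{1/\theta}$, $t\ge0$, and put $$\|X\|_{\Psi_{\theta,L}}:=\inf\{\eta>0:\ \mathbb E\,\Psi_{\theta,L}(|X|/\eta)\le 1\}\in[0,\infty].$$ Let $\gamma\approx1.78$ be the smallest $k>1$ with $e^{2k^{-2}}-1+\dfrac{e^{2(1-k^2)/k^2}}{k^2-1}\le1$. Let $$C(\theta):=\begin{cases}2\Big[(\log 2)^{1/\theta}+e^3\Big(\Gamma^{1/2}\big(\tfrac2\theta+1\big)+3^{\frac{2-\theta}{3\theta}}\sup_{p\ge2}p^{-1/\theta}\,\Gamma^{1/p}\big(\tfrac p\theta+1\big)\Big)\Big],&\theta\le1,\\[1ex] 2\big[4e+(\log2)^{1/\theta}\big],&\theta>1,\end{cases}$$ $$A(\theta):=\inf_{p\ge2}\frac{e^3\,3^{\frac{2-\theta}{3\theta}}\,p^{-1/\theta}\,\Gamma^{1/p}\big(\tfrac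 p\theta+1\big)}{C(\theta)}\quad(\theta\le1),\qquad B(\theta):=\frac{2e\,\theta^{-1/\theta}(1-\theta^{-1})^{1/\beta}}{4e+(\log2)^{1/\theta}}\quad(\theta>1),$$ where $\beta=\theta/(\theta-1)$ is the Hölder conjugate of $\theta>1$ and $p$ ranges over real numbers. For $b\in\mathbb R^n$, $b\neq0$, let $$L_n(\theta,b):=\gamma^{2/\theta}A(\theta)\frac{\|b\|_\infty}{\|b\|_2}\ \text{ if }\theta\le1,\qquad L_n(\theta,b):=\gamma^{2/\theta}B(\theta)\frac{\|b\|_\beta}{\|b\|_2}\ \text{ if }\theta>1,$$ and $L_n(\theta,0):=0$. **Theorem.** Let $\theta>0$, let $X_1,\dots,X_n$ be independent real random variables with $\mathbb EX_i=0$ and $\|X_i\|_{\psi_\theta}<\infty$ for all $i$, and let $w\in\mathbb R^n$. Put $b_X:=(w_1\|X_1\|_{\psi_\theta},\dots,w_n\|X_n\|_{\psi_\theta})$ and $L_n:=L_n(\theta,b_X)$. (a) $\displaystyle\Big\|\sum_{i=1}^nw_iX_i\Big\|_{\Psi_{\theta,L_n}}\le\gamma\,e\,C(\theta)\,\|b_X\|_2.$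 Suppose moreover that $b_X\ne0$. Then: (b) For all $t\ge0$, $$\mathbb P\Big(\Big|\sum_{i=1}^nw_iX_i\Big|\ge 2eC(\theta)\|b_X\|_2\{\sqrt t+L_nt^{1/\theta}\}\Big)\le2e^{-t}.$$ (c) If $\theta\ne2$, then for all $s\ge0$, $$\mathbb P\Big(\Big|\sum_{i=1}^nw_iX_i\Big|\ge s\Big)\le 2\exp\Big\{-\Big(\frac{s^\theta}{[4eC(\theta)\|b_X\|_2L_n]^\theta}\wedge\frac{s^2}{16e^2C(\theta)^2\|b_X\|_2^2}\Big)\Big\},$$ and, with $s_0:=4eC(\theta)\|b_X\|_2L_n^{\theta/(\theta-2)}$, the right-hand side equals, for $\theta<2$, $$2e^{-s^2/(16e^2C(\theta)^2\|b_X\|_2^2)}\ \text{ if }s\le s_0,\qquad 2e^{-s^\theta/[4eC(\theta)\|b_X\|_2L_n]^\theta}\ \text{ if }s>s_0,$$ and, for $\theta>2$, $$2e^{-s^\theta/[4eC(\theta)\|b_X\|_2L_n]^\theta}\ \text{ if }s<s_0,\qquad 2e^{-s^2/(16e^2C(\theta)^2\|b_X\|_2^2)}\ \text{ if }s\ge s_0.$$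 -/

import Mathlib

open MeasureTheory ProbabilityTheory
open scoped ENNReal

noncomputable section

namespace SubWeibull

/-- The sub-Weibull norm `‖X‖_{ψ_θ} = inf {c > 0 : E exp(|X|^θ / c^θ) ≤ 2}`, with values in
`[0, ∞]`; it is `∞` when no such `c` exists. -/
def psiNorm {Ω : Type*} [MeasurableSpace Ω] (μ : Measure Ω) (θ : ℝ) (X : Ω → ℝ) : ℝ≥0∞ :=
  sInf (ENNReal.ofReal ''
    {c : ℝ | 0 < c ∧ ∫⁻ ω, ENNReal.ofReal (Real.exp (|X ω| ^ θ / c ^ θ)) ∂μ ≤ 2})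

/-- The function `Ψ_{θ,L}⁻¹(t) = √(log (t + 1)) + L (log (t + 1))^{1/θ}`, for `t ≥ 0`. -/
def gboInv (θ L t : ℝ) : ℝ :=
  √(Real.log (t + 1)) + L * Real.log (t + 1) ^ (1 / θ)

/-- The function `Ψ_{θ,L} : [0, ∞) → [0, ∞)`, the inverse of `gboInv θ L` on `[0, ∞)`. -/
def gboFun (θ L x : ℝ) : ℝ :=
  Function.invFunOn (gboInv θ L) (Set.Ici 0) x

theorem gboInv_bijOn {θ L : ℝ} (hθ : 0 < θ) (hL : 0 ≤ L) :
    Set.BijOn (gboInv θ L) (Set.Ici 0) (Set.Ici 0) := by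
  have hlog : ∀ t : ℝ, 0 ≤ t → 0 ≤ Real.log (t + 1) := fun t ht =>
    Real.log_nonneg (by linarith)
  have h0 : gboInv θ L 0 = 0 := by
    have : (1 / θ) ≠ 0 := by positivity
    simp only [gboInv, zero_add, Real.log_one, Real.sqrt_zero, Real.zero_rpow this, mul_zero]
  have hmono : StrictMonoOn (gboInv θ L) (Set.Ici 0) := by
    intro s hs t ht hst
    have hs' : (0 : ℝ) ≤ s := hs
    have hlt : Real.log (s + 1) < Real.log (t + 1) :=
      Real.log_lt_log (by linarith) (by linarith)
    have h1 : √(Real.log (s + 1)) < √(Real.log (t + 1)) :=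
      Real.sqrt_lt_sqrt (hlog s hs') hlt
    have h2 : Real.log (s + 1) ^ (1 / θ) ≤ Real.log (t + 1) ^ (1 / θ) :=
      Real.rpow_le_rpow (hlog s hs') hlt.le (by positivity)
    have h3 := mul_le_mul_of_nonneg_left h2 hL
    simp only [gboInv]
    linarith
  have hmaps : Set.MapsTo (gboInv θ L) (Set.Ici 0) (Set.Ici 0) := by
    intro t ht
    have := hlog t ht
    simp only [gboInv, Set.mem_Ici]
    positivity
  refine ⟨hmaps, hmono.injOn, ?_⟩
  intro x hx
  have hx' : (0 : ℝ) ≤ x := hx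
  have hcont : ContinuousOn (gboInv θ L) (Set.Icc 0 (Real.exp (x ^ 2) - 1)) := by
    have hl : ContinuousOn (fun t : ℝ => Real.log (t + 1))
        (Set.Icc 0 (Real.exp (x ^ 2) - 1)) := by
      refine ContinuousOn.log (by fun_prop) ?_
      intro t ht
      have := ht.1
      linarith
    exact hl.sqrt.add
      (continuousOn_const.mul (hl.rpow_const fun t _ => Or.inr (by positivity)))
  have hle : (0 : ℝ) ≤ Real.exp (x ^ 2) - 1 := by
    have := Real.one_le_exp (sq_nonneg x)
    linarith
  have hend : x ≤ gboInv θ L (Real.exp (x ^ 2) - 1) := by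
    have hnn : 0 ≤ L * (x ^ 2) ^ (1 / θ) := by positivity
    simp only [gboInv, sub_add_cancel, Real.log_exp, Real.sqrt_sq hx']
    linarith
  obtain ⟨t, ht, hxt⟩ := intermediate_value_Icc hle hcont ⟨by rw [h0]; exact hx', hend⟩
  exact ⟨t, ht.1, hxt⟩

/-- `gboFun θ L` and `gboInv θ L` are inverse to each other on `[0, ∞)`. -/
theorem gboFun_invOn {θ L : ℝ} (hθ : 0 < θ) (hL : 0 ≤ L) :
    Set.InvOn (gboFun θ L) (gboInv θ L) (Set.Ici 0) (Set.Ici 0) :=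
  (gboInv_bijOn hθ hL).invOn_invFunOn

/-- The generalized Bernstein-Orlicz norm
`‖X‖_{Ψ_{θ,L}} = inf {η > 0 : E Ψ_{θ,L}(|X| / η) ≤ 1}`, with values in `[0, ∞]`. -/
def gboNorm {Ω : Type*} [MeasurableSpace Ω] (μ : Measure Ω) (θ L : ℝ) (X : Ω → ℝ) : ℝ≥0∞ :=
  sInf (ENNReal.ofReal ''
    {η : ℝ | 0 < η ∧ ∫⁻ ω, ENNReal.ofReal (gboFun θ L (|X ω| / η)) ∂μ ≤ 1})

/-- The constant `γ ≈ 1.78`, the smallest `k > 1` with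
`e^{2 k⁻²} - 1 + e^{2 (1 - k²) / k²} / (k² - 1) ≤ 1`. -/
def gam : ℝ :=
  sInf {k : ℝ | 1 < k ∧
    Real.exp (2 / k ^ 2) - 1 + Real.exp (2 * (1 - k ^ 2) / k ^ 2) / (k ^ 2 - 1) ≤ 1}

/-- `p^{-1/θ} Γ(p/θ + 1)^{1/p}`. -/
def gammaTerm (θ p : ℝ) : ℝ :=
  p ^ (-(1 / θ)) * Real.Gamma (p / θ + 1) ^ (1 / p)

/-- The value of `C(θ)` for `θ ≤ 1`. -/
def constCLow (θ : ℝ) : ℝ :=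
  2 * (Real.log 2 ^ (1 / θ) + Real.exp 3 *
    (Real.Gamma (2 / θ + 1) ^ ((1 : ℝ) / 2) +
      3 ^ ((2 - θ) / (3 * θ)) * ⨆ p : Set.Ici (2 : ℝ), gammaTerm θ p))

/-- The constant `C(θ)`. -/
def constC (θ : ℝ) : ℝ :=
  if θ ≤ 1 then constCLow θ else 2 * (4 * Real.exp 1 + Real.log 2 ^ (1 / θ))

/-- The constant `A(θ)`, used for `0 < θ ≤ 1`. -/
def constA (θ : ℝ) : ℝ :=
  ⨅ p : Set.Ici (2 : ℝ),
    Real.exp 3 * 3 ^ ((2 - θ) / (3 * θ)) * gammaTerm θ p / constCLow θ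

/-- The Hölder conjugate `β` of `θ`, so that `1/θ + 1/β = 1` (used for `θ > 1`). -/
def conj (θ : ℝ) : ℝ := θ / (θ - 1)

/-- The constant `B(θ)`, used for `θ > 1`. -/
def constB (θ : ℝ) : ℝ :=
  2 * Real.exp 1 * θ ^ (-(1 / θ)) * (1 - θ⁻¹) ^ (1 / conj θ) /
    (4 * Real.exp 1 + Real.log 2 ^ (1 / θ))

/-- The `ℓ_q` norm of a vector, for real `q ≥ 1`. -/
def vecNorm {n : ℕ} (q : ℝ) (b : Fin n → ℝ) : ℝ := (∑ i, |b i| ^ q) ^ (1 / q)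

/-- The quantity `L_n(θ, b)`. The norm `‖b‖` on `Fin n → ℝ` is the maximum norm. For `b = 0`
both cases evaluate to `0`. -/
def constL {n : ℕ} (θ : ℝ) (b : Fin n → ℝ) : ℝ :=
  if θ ≤ 1 then gam ^ (2 / θ) * constA θ * (‖b‖ / vecNorm 2 b)
  else gam ^ (2 / θ) * constB θ * (vecNorm (conj θ) b / vecNorm 2 b)

/-- The vector `b_X = (w_i ‖X_i‖_{ψ_θ})_i`. -/
def bVec {Ω : Type*} [MeasurableSpace Ω] (μ : Measure Ω) {n : ℕ} (θ : ℝ) (w : Fin n → ℝ)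
    (X : Fin n → Ω → ℝ) : Fin n → ℝ :=
  fun i => w i * (psiNorm μ θ (X i)).toReal

end SubWeibull

end

/-! Dividing by the sub-Weibull norms turns the sum into `Y = ∑ b i * ξ i` with `E exp(|ξ i|^θ) ≤
2`. Everything then follows from one tail estimate, `measureReal_abs_sum_ge_le`: with `p = γ² y ≥
2`, the probability that `|Y|` reaches `γ e C ‖b‖₂ (√y + L y^{1/θ})` is at most `exp(-p)`. The
factor `γ` and the `γ^{2/θ}` inside `L` absorb the passage from `y` to `p`.

For `θ ≤ 1` exponential moments need not exist, so each summand is truncated at a third `T` of the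
threshold. Below `T`, `|bx|/T ≤ (|bx|/T)^θ`, so at rate `p/T` the exponent is dominated by `ρ|x|^θ`
with `ρ < 1`. Chernoff's bound handles the truncated sum, and a union bound with the same moment
handles the large summands. For `θ > 1` the moment generating function is finite: it is at most
`exp(8e y² + (κ|y|)^β)`, by a second-order expansion for small `y` and Young's inequality for large
`y`. Chernoff's bound with a rate balancing the two terms concludes. The Gamma functions in `C` and
`A` enter only through `Γ(x+1) ≥ (x/e)^x`.

Integrating the tail of `Ψ(|Y|/K)` and bounding the probability by 1 up to `p = 2` gives exactly the
expression defining `γ`, hence (a). Markov's inequality for `Ψ + 1` and `γ ≤ 2` give (b). Choosing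
`t` so that both `√t` and `L t^{1/θ}` are at most `s/(4eC‖b‖₂)` gives (c). -/

namespace SubWeibull

/-! ### Elementary inequalities -/

theorem exp_le_one_add_add_sq_mul_exp_abs (u : ℝ) :
    Real.exp u ≤ 1 + u + u ^ 2 * Real.exp |u| := by
  have h := Complex.norm_exp_sub_sum_le_norm_mul_exp (u : ℂ) 2
  have h2 : Complex.exp u - ∑ m ∈ Finset.range 2, (u : ℂ) ^ m / (m.factorial : ℂ)
      = ((Real.exp u - (1 + u) : ℝ) : ℂ) := by
    simp [Finset.sum_range_succ]
  rw [h2, Complex.norm_real, Complex.norm_real, Real.norm_eq_abs, Real.norm_eq_abs, sq_abs] at h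
  linarith [le_abs_self (Real.exp u - (1 + u))]

/-- Restrict the Gamma integral to `t > x`, where `t^x ≥ x^x`; what remains is `x^x e^{-x}`. -/
theorem div_exp_one_rpow_le_Gamma {x : ℝ} (hx : 0 < x) :
    (x / Real.exp 1) ^ x ≤ Real.Gamma (x + 1) := by
  rw [Real.Gamma_eq_integral (by linarith)]
  have hint : IntegrableOn (fun t : ℝ => Real.exp (-t) * t ^ (x + 1 - 1)) (Set.Ioi 0) :=
    Real.GammaIntegral_convergent (by linarith)
  have h1 : ∫ t in Set.Ioi x, Real.exp (-t) * x ^ x ≤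
      ∫ t in Set.Ioi x, Real.exp (-t) * t ^ (x + 1 - 1) := by
    refine setIntegral_mono_on ((integrableOn_exp_neg_Ioi x).mul_const _)
      (hint.mono_set (Set.Ioi_subset_Ioi hx.le)) measurableSet_Ioi fun t ht => ?_
    rw [add_sub_cancel_right]
    exact mul_le_mul_of_nonneg_left
      (Real.rpow_le_rpow hx.le (le_of_lt ht) hx.le) (Real.exp_nonneg _)
  have h2 : ∫ t in Set.Ioi x, Real.exp (-t) * t ^ (x + 1 - 1) ≤
      ∫ t in Set.Ioi 0, Real.exp (-t) * t ^ (x + 1 - 1) := by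
    refine setIntegral_mono_set hint ?_ (Set.Ioi_subset_Ioi hx.le).eventuallyLE
    filter_upwards [ae_restrict_mem measurableSet_Ioi] with t ht
    have : (0 : ℝ) < t := ht
    simp only [Pi.zero_apply]
    positivity
  rw [integral_mul_const, integral_exp_neg_Ioi] at h1
  refine le_trans (le_of_eq ?_) (h1.trans h2)
  rw [Real.div_rpow hx.le (Real.exp_nonneg _), ← Real.exp_mul, one_mul, Real.exp_neg]
  ring

/-- The maximum of `y ^ r * exp (-(a * y))` over `y ≥ 0` is at `y = r / a`. -/
theorem rpow_le_mul_exp {r a y : ℝ} (hr : 0 < r) (ha : 0 < a) (hy : 0 ≤ y) :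
    y ^ r ≤ (r / (Real.exp 1 * a)) ^ r * Real.exp (a * y) := by
  have h1 : a * y / r ≤ Real.exp (a * y / r - 1) := by
    have := Real.add_one_le_exp (a * y / r - 1); linarith
  have h2 : y ≤ r / (Real.exp 1 * a) * Real.exp (a * y / r) := by
    rw [Real.exp_sub, div_le_div_iff₀ hr (Real.exp_pos _)] at h1
    rw [div_mul_eq_mul_div, le_div_iff₀ (by positivity)]
    linarith
  calc y ^ r ≤ (r / (Real.exp 1 * a) * Real.exp (a * y / r)) ^ r :=
        Real.rpow_le_rpow hy h2 hr.le
    _ = _ := by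
        rw [Real.mul_rpow (by positivity) (Real.exp_nonneg _), ← Real.exp_mul]
        congr 2
        field_simp

/-- Young's inequality with the constant of the Legendre transform of `x ↦ x ^ θ`. -/
theorem mul_le_rpow_add_rpow {θ x y : ℝ} (hθ : 1 < θ) (hx : 0 ≤ x) (hy : 0 ≤ y) :
    y * x ≤ x ^ θ +
      (θ ^ (-(1 / θ)) * (1 - θ⁻¹) ^ (1 / conj θ)) ^ conj θ * y ^ conj θ := by
  have h0 : 0 < θ := by linarith
  have hc : θ.HolderConjugate (conj θ) := Real.HolderConjugate.conjExponent hθ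
  have hcpos : 0 < conj θ := hc.symm.pos
  have hinv : 1 - θ⁻¹ = (conj θ)⁻¹ := hc.one_sub_inv
  -- The factor `θ^{1/θ}` is moved between the two arguments so that `x^θ` gets coefficient exactly
  -- 1, matching the moment `E exp(|ξ|^θ)`.
  have h := Real.young_inequality_of_nonneg (a := θ ^ (1 / θ) * x) (b := θ ^ (-(1 / θ)) * y)
    (by positivity) (by positivity) hc
  have e1 : θ ^ (1 / θ) * x * (θ ^ (-(1 / θ)) * y) = y * x := by
    rw [Real.rpow_neg h0.le]
    field_simp
  have e2 : (θ ^ (1 / θ) * x) ^ θ / θ = x ^ θ := by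
    rw [Real.mul_rpow (by positivity) hx, ← Real.rpow_mul h0.le, one_div_mul_cancel h0.ne',
      Real.rpow_one]
    field_simp
  have e3 : (θ ^ (-(1 / θ)) * y) ^ conj θ / conj θ =
      (θ ^ (-(1 / θ)) * (1 - θ⁻¹) ^ (1 / conj θ)) ^ conj θ * y ^ conj θ := by
    rw [hinv, Real.mul_rpow (by positivity) hy, Real.mul_rpow (by positivity) (by positivity),
      ← Real.rpow_mul (by positivity) (1 / conj θ), one_div_mul_cancel hcpos.ne', Real.rpow_one]
    ring
  rw [e1, e2, e3] at h
  exact h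

/-! ### The constant γ -/

theorem two_mem_gam_set : 1 < (2 : ℝ) ∧
    Real.exp (2 / 2 ^ 2) - 1 + Real.exp (2 * (1 - 2 ^ 2) / 2 ^ 2) / (2 ^ 2 - 1) ≤ 1 := by
  refine ⟨by norm_num, ?_⟩
  have e1 : Real.exp (2 / 2 ^ 2) ≤ 17 / 10 := by
    have h : Real.exp (2 / 2 ^ 2) ^ 2 = Real.exp 1 := by rw [← Real.exp_nat_mul]; norm_num
    have := Real.exp_one_lt_d9
    have := Real.exp_pos (2 / 2 ^ 2)
    nlinarith
  have e2 : Real.exp (2 * (1 - 2 ^ 2) / 2 ^ 2) ≤ 1 / 2 := by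
    have h : Real.exp (2 * (1 - 2 ^ 2) / 2 ^ 2) ≤ Real.exp (-1) :=
      Real.exp_le_exp.2 (by norm_num)
    have := Real.exp_neg_one_lt_d9
    linarith
  norm_num at e1 e2 ⊢
  linarith

/-- The set whose infimum is `gam` contains it. -/
theorem gam_mem : 1 < gam ∧
    Real.exp (2 / gam ^ 2) - 1 +
      Real.exp (2 * (1 - gam ^ 2) / gam ^ 2) / (gam ^ 2 - 1) ≤ 1 := by
  set S : Set ℝ := {k : ℝ | 1 < k ∧
    Real.exp (2 / k ^ 2) - 1 + Real.exp (2 * (1 - k ^ 2) / k ^ 2) / (k ^ 2 - 1) ≤ 1} with hS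
  -- Every admissible `k` satisfies `k² - 1 ≥ exp(2(1-k²)/k²) ≥ e^{-2}`. This keeps the set away
  -- from the pole at 1, so it is closed and contains its infimum.
  set d : ℝ := √(1 + Real.exp (-2)) with hd
  have hd1 : 1 < d := by
    rw [hd, Real.lt_sqrt (by norm_num)]
    have := Real.exp_pos (-2); linarith
  have hd2 : d ^ 2 = 1 + Real.exp (-2) := Real.sq_sqrt (by positivity)
  have hSd : ∀ k ∈ S, d ≤ k := by
    rintro k ⟨hk, h⟩
    have hk2 : 0 < k ^ 2 - 1 := by nlinarith
    have h1 : 0 ≤ Real.exp (2 / k ^ 2) - 1 := by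
      have := Real.one_le_exp (x := 2 / k ^ 2) (by positivity); linarith
    have h2 : Real.exp (2 * (1 - k ^ 2) / k ^ 2) ≤ k ^ 2 - 1 := by
      rw [← div_le_one hk2]; linarith
    have h3 : Real.exp (-2) ≤ Real.exp (2 * (1 - k ^ 2) / k ^ 2) := by
      apply Real.exp_le_exp.2
      rw [le_div_iff₀ (by positivity)]; linarith
    exact Real.sqrt_le_iff.2 ⟨by linarith, by linarith⟩
  have hclosed : IsClosed S := by
    have hcont : ContinuousOn (fun k : ℝ => Real.exp (2 / k ^ 2) - 1 +
        Real.exp (2 * (1 - k ^ 2) / k ^ 2) / (k ^ 2 - 1)) (Set.Ici d) := by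
      have hne : ∀ k ∈ Set.Ici d, k ^ 2 ≠ 0 := fun k hk => by
        have : d ≤ k := hk
        have : 0 < k := by linarith
        positivity
      have hne' : ∀ k ∈ Set.Ici d, k ^ 2 - 1 ≠ 0 := fun k hk => by
        have : d ≤ k := hk
        nlinarith
      refine ContinuousOn.add (ContinuousOn.sub ?_ continuousOn_const) (ContinuousOn.div ?_ ?_ hne')
      · exact (continuousOn_const.div (by fun_prop) hne).rexp
      · exact (ContinuousOn.div (by fun_prop) (by fun_prop) hne).rexp
      · fun_prop
    have : S = Set.Ici d ∩ (fun k : ℝ => Real.exp (2 / k ^ 2) - 1 +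
        Real.exp (2 * (1 - k ^ 2) / k ^ 2) / (k ^ 2 - 1)) ⁻¹' Set.Iic 1 := by
      ext k
      exact ⟨fun h => ⟨hSd k h, h.2⟩, fun h => ⟨hd1.trans_le h.1, h.2⟩⟩
    rw [this]
    exact hcont.preimage_isClosed_of_isClosed isClosed_Ici isClosed_Iic
  exact hclosed.csInf_mem ⟨2, two_mem_gam_set⟩ ⟨d, hSd⟩

theorem gam_le_two : gam ≤ 2 :=
  csInf_le ⟨1, fun _ hk => hk.1.le⟩ two_mem_gam_set

/-! ### Chernoff's bound and truncation -/

section Tail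

variable {Ω : Type*} [MeasurableSpace Ω] {μ : Measure Ω} [IsProbabilityMeasure μ] {n : ℕ}

/-- Chernoff's bound for a sum of independent random variables. -/
theorem measureReal_ge_sum_le_exp {V : Fin n → Ω → ℝ} (hV : ∀ i, Measurable (V i))
    (hind : iIndepFun V μ) {l : ℝ} (hl : 0 ≤ l) {a : Fin n → ℝ}
    (hint : ∀ i, Integrable (fun ω => Real.exp (l * V i ω)) μ)
    (hmgf : ∀ i, ∫ ω, Real.exp (l * V i ω) ∂μ ≤ Real.exp (a i)) (s : ℝ) :
    μ.real {ω | s ≤ ∑ i, V i ω} ≤ Real.exp (∑ i, a i - l * s) := by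
  have h1 := measure_ge_le_exp_mul_mgf (μ := μ) (X := ∑ i, V i) s hl
    (hind.integrable_exp_mul_sum hV (s := Finset.univ) fun i _ => hint i)
  rw [hind.mgf_sum hV] at h1
  have h2 : ∏ i, mgf (V i) μ l ≤ Real.exp (∑ i, a i) := by
    rw [Real.exp_sum]
    exact Finset.prod_le_prod (fun i _ => mgf_nonneg) fun i _ => hmgf i
  simp only [Finset.sum_apply] at h1
  refine h1.trans ((mul_le_mul_of_nonneg_left h2 (Real.exp_nonneg _)).trans_eq ?_)
  rw [← Real.exp_add]
  ring_nf

/-- `b * x` truncated at the level `T`. -/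
noncomputable def truncMul (T b x : ℝ) : ℝ := if |b * x| ≤ T then b * x else 0

@[fun_prop]
theorem measurable_truncMul (T b : ℝ) : Measurable (truncMul T b) :=
  Measurable.ite (measurableSet_le (by fun_prop) measurable_const) (by fun_prop) measurable_const

theorem truncMul_neg (T b x : ℝ) : truncMul T (-b) x = -truncMul T b x := by
  unfold truncMul
  rw [neg_mul, abs_neg, neg_ite, neg_zero]

/-- Pointwise estimate behind the moment generating function of a truncated variable. -/
theorem exp_truncMul_le {θ p T ρ b : ℝ} (hθ1 : θ ≤ 1) (hp : 0 ≤ p) (hT : 0 < T)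
    (hρ : 0 ≤ ρ) (hb : p * |b| ^ θ ≤ ρ * T ^ θ) (x : ℝ) :
    Real.exp (p / T * truncMul T b x) ≤
      1 + p / T * b * x + (p + p ^ 2) / T ^ 2 * b ^ 2 * (x ^ 2 * Real.exp (ρ * |x| ^ θ)) := by
  have hE1 : 1 ≤ Real.exp (ρ * |x| ^ θ) := Real.one_le_exp (by positivity)
  unfold truncMul
  split_ifs with h
  · have h1 := exp_le_one_add_add_sq_mul_exp_abs (p / T * (b * x))
    have h2 : |p / T * (b * x)| ≤ ρ * |x| ^ θ := by
      rw [abs_mul, abs_of_nonneg (by positivity : 0 ≤ p / T)]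
      -- The use of `θ ≤ 1`: on `[0,1]` a number is at most its `θ`-th power.
      have h3 : |b * x| / T ≤ (|b * x| / T) ^ θ :=
        Real.self_le_rpow_of_le_one (by positivity) ((div_le_one hT).2 h) hθ1
      calc p / T * |b * x| = p * (|b * x| / T) := by ring
        _ ≤ p * (|b * x| / T) ^ θ := by gcongr
        _ = (p * |b| ^ θ) * |x| ^ θ / T ^ θ := by
          rw [Real.div_rpow (abs_nonneg _) hT.le, abs_mul,
            Real.mul_rpow (abs_nonneg _) (abs_nonneg _)]
          ring
        _ ≤ (ρ * T ^ θ) * |x| ^ θ / T ^ θ := by gcongr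
        _ = ρ * |x| ^ θ := by
          have : 0 < T ^ θ := by positivity
          field_simp
    have h4 : (p / T * (b * x)) ^ 2 * Real.exp |p / T * (b * x)| ≤
        p ^ 2 / T ^ 2 * b ^ 2 * (x ^ 2 * Real.exp (ρ * |x| ^ θ)) := by
      calc _ ≤ (p / T * (b * x)) ^ 2 * Real.exp (ρ * |x| ^ θ) := by gcongr
        _ = _ := by ring
    have h5 : 0 ≤ p / T ^ 2 * b ^ 2 * (x ^ 2 * Real.exp (ρ * |x| ^ θ)) := by positivity
    have h6 : (p + p ^ 2) / T ^ 2 * b ^ 2 * (x ^ 2 * Real.exp (ρ * |x| ^ θ)) =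
      p / T ^ 2 * b ^ 2 * (x ^ 2 * Real.exp (ρ * |x| ^ θ)) +
      p ^ 2 / T ^ 2 * b ^ 2 * (x ^ 2 * Real.exp (ρ * |x| ^ θ)) := by ring
    linarith
  · push Not at h
    rw [mul_zero, Real.exp_zero]
    -- Where the variable is cut to 0 the linear term survives on the right. Since `|bx| > T` it is
    -- at most quadratic, which costs the extra `p` in `p + p²`; the truncated variable thus needs
    -- no recentring.
    have h1 : |p / T * b * x| ≤ p / T ^ 2 * b ^ 2 * x ^ 2 := by
      rw [mul_assoc, abs_mul, abs_of_nonneg (by positivity : 0 ≤ p / T)]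
      have h3 : |b * x| ≤ |b * x| ^ 2 / T := by
        rw [le_div_iff₀ hT, sq]
        gcongr
      calc p / T * |b * x| ≤ p / T * (|b * x| ^ 2 / T) := by gcongr
        _ = _ := by rw [sq_abs]; field_simp
    have h2 : p / T ^ 2 * b ^ 2 * x ^ 2 ≤
        (p + p ^ 2) / T ^ 2 * b ^ 2 * (x ^ 2 * Real.exp (ρ * |x| ^ θ)) := by
      rw [← mul_one (x ^ 2)]
      have : p ≤ p + p ^ 2 := by nlinarith
      gcongr
      linarith
    linarith [neg_le_of_abs_le h1]

/-- Pointwise estimate behind the tail of a single variable above the truncation level. -/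
theorem one_le_of_lt_abs_mul {θ p T ρ b x : ℝ} (hθ : 0 < θ) (hT : 0 < T)
    (hb : p * |b| ^ θ ≤ ρ * T ^ θ) (h : T < |b * x|) (hρ : 0 ≤ ρ) :
    1 ≤ Real.exp (-p) / T ^ 2 * b ^ 2 * (x ^ 2 * Real.exp (ρ * |x| ^ θ)) := by
  have hb0 : 0 < |b| := by
    rw [abs_pos]
    rintro rfl
    simp at h
    linarith
  have h1 : p ≤ ρ * |x| ^ θ := by
    have h2 : T ^ θ ≤ |b| ^ θ * |x| ^ θ := by
      rw [← Real.mul_rpow (abs_nonneg _) (abs_nonneg _), ← abs_mul]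
      gcongr
    have h3 : 0 < |b| ^ θ := by positivity
    have h4 : p * |b| ^ θ ≤ (ρ * |x| ^ θ) * |b| ^ θ := by
      calc p * |b| ^ θ ≤ ρ * T ^ θ := hb
        _ ≤ ρ * (|b| ^ θ * |x| ^ θ) := by gcongr
        _ = _ := by ring
    exact le_of_mul_le_mul_right h4 h3
  have h5 : T ^ 2 ≤ b ^ 2 * x ^ 2 := by
    rw [← mul_pow, ← sq_abs (b * x)]
    gcongr
  calc (1 : ℝ) = Real.exp (-p) / T ^ 2 * T ^ 2 * Real.exp p := by
        rw [Real.exp_neg]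
        field_simp
    _ ≤ Real.exp (-p) / T ^ 2 * (b ^ 2 * x ^ 2) * Real.exp (ρ * |x| ^ θ) := by gcongr
    _ = _ := by ring

/-- The tail of a weighted sum of independent centred variables with a stretched exponential
moment: one side of the truncated part. -/
theorem measureReal_ge_sum_truncMul_le {ξ : Fin n → Ω → ℝ} (hξ : ∀ i, Measurable (ξ i))
    (hind : iIndepFun ξ μ) (hmean : ∀ i, ∫ ω, ξ i ω ∂μ = 0) {θ p T ρ W : ℝ} {b : Fin n → ℝ}
    (hθ1 : θ ≤ 1) (hp : 0 ≤ p) (hT : 0 < T) (hρ : 0 ≤ ρ)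
    (hb : ∀ i, p * |b i| ^ θ ≤ ρ * T ^ θ) (hξint : ∀ i, Integrable (ξ i) μ)
    (hint : ∀ i, Integrable (fun ω => ξ i ω ^ 2 * Real.exp (ρ * |ξ i ω| ^ θ)) μ)
    (hW : ∀ i, ∫ ω, ξ i ω ^ 2 * Real.exp (ρ * |ξ i ω| ^ θ) ∂μ ≤ W) (s : ℝ) :
    μ.real {ω | s ≤ ∑ i, truncMul T (b i) (ξ i ω)} ≤
      Real.exp ((p + p ^ 2) / T ^ 2 * (∑ i, b i ^ 2) * W - p / T * s) := by
  have hdom : ∀ i, Integrable (fun ω => 1 + p / T * b i * ξ i ω +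
      (p + p ^ 2) / T ^ 2 * b i ^ 2 * (ξ i ω ^ 2 * Real.exp (ρ * |ξ i ω| ^ θ))) μ := fun i =>
    ((integrable_const _).add ((hξint i).const_mul _)).add ((hint i).const_mul _)
  have hle : ∀ i ω, Real.exp (p / T * truncMul T (b i) (ξ i ω)) ≤ 1 + p / T * b i * ξ i ω +
      (p + p ^ 2) / T ^ 2 * b i ^ 2 * (ξ i ω ^ 2 * Real.exp (ρ * |ξ i ω| ^ θ)) := fun i ω =>
    exp_truncMul_le hθ1 hp hT hρ (hb i) _
  have hexp : ∀ i, Integrable (fun ω => Real.exp (p / T * truncMul T (b i) (ξ i ω))) μ := by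
    intro i
    refine (hdom i).mono' ?_ (Filter.Eventually.of_forall fun ω => ?_)
    · have := hξ i
      exact Measurable.aestronglyMeasurable (by fun_prop)
    · rw [Real.norm_eq_abs, Real.abs_exp]
      exact hle i ω
  refine (measureReal_ge_sum_le_exp (V := fun i ω => truncMul T (b i) (ξ i ω))
    (fun i => (measurable_truncMul T (b i)).comp (hξ i))
    (hind.comp (fun i => truncMul T (b i)) fun i => measurable_truncMul T (b i))
    (l := p / T) (by positivity) (a := fun i => (p + p ^ 2) / T ^ 2 * b i ^ 2 * W)
    hexp (fun i => ?_) s).trans_eq ?_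
  · calc _ ≤ ∫ ω, 1 + p / T * b i * ξ i ω +
          (p + p ^ 2) / T ^ 2 * b i ^ 2 * (ξ i ω ^ 2 * Real.exp (ρ * |ξ i ω| ^ θ)) ∂μ :=
          integral_mono (hexp i) (hdom i) (hle i)
      _ = 1 + (p + p ^ 2) / T ^ 2 * b i ^ 2 *
            ∫ ω, ξ i ω ^ 2 * Real.exp (ρ * |ξ i ω| ^ θ) ∂μ := by
          have h0 : Integrable (fun ω => 1 + p / T * b i * ξ i ω) μ :=
            (integrable_const _).add ((hξint i).const_mul _)
          rw [integral_add h0 ((hint i).const_mul _), integral_add (integrable_const _)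
            ((hξint i).const_mul _), integral_const_mul, integral_const_mul, hmean i]
          simp
      _ ≤ 1 + (p + p ^ 2) / T ^ 2 * b i ^ 2 * W := by
          have := hW i
          gcongr
      _ ≤ _ := by
          have := Real.add_one_le_exp ((p + p ^ 2) / T ^ 2 * b i ^ 2 * W)
          linarith
  · simp_rw [Finset.mul_sum, Finset.sum_mul]

/-- The tail of a weighted sum of independent centred variables with a stretched exponential
moment, by truncation at the level `T`. -/
theorem measureReal_abs_sum_ge_le_of_truncation {ξ : Fin n → Ω → ℝ}
    (hξ : ∀ i, Measurable (ξ i))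
    (hind : iIndepFun ξ μ) (hmean : ∀ i, ∫ ω, ξ i ω ∂μ = 0) {θ p T ρ W : ℝ} {b : Fin n → ℝ}
    (hθ : 0 < θ) (hθ1 : θ ≤ 1) (hp : 2 ≤ p) (hT : 0 < T) (hρ : 0 ≤ ρ)
    (hb : ∀ i, p * |b i| ^ θ ≤ ρ * T ^ θ) (hξint : ∀ i, Integrable (ξ i) μ)
    (hint : ∀ i, Integrable (fun ω => ξ i ω ^ 2 * Real.exp (ρ * |ξ i ω| ^ θ)) μ)
    (hW : ∀ i, ∫ ω, ξ i ω ^ 2 * Real.exp (ρ * |ξ i ω| ^ θ) ∂μ ≤ W)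
    (hTW : 3 * p * W * ∑ i, b i ^ 2 ≤ 2 * T ^ 2) :
    μ.real {ω | 3 * T ≤ |∑ i, b i * ξ i ω|} ≤ Real.exp (-p) := by
  have hsub : {ω | 3 * T ≤ |∑ i, b i * ξ i ω|} ⊆
      (⋃ i, {ω | T < |b i * ξ i ω|}) ∪
        ({ω | 3 * T ≤ ∑ i, truncMul T (b i) (ξ i ω)} ∪
          {ω | 3 * T ≤ ∑ i, truncMul T (-b i) (ξ i ω)}) := by
    intro ω hω
    by_cases h : ∃ i, T < |b i * ξ i ω|
    · exact Or.inl (Set.mem_iUnion.2 h)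
    · right
      push Not at h
      have : ∑ i, b i * ξ i ω = ∑ i, truncMul T (b i) (ξ i ω) :=
        Finset.sum_congr rfl fun i _ => by rw [truncMul, if_pos (h i)]
      simp only [Set.mem_ofPred_eq, this] at hω
      simp only [Set.mem_union, Set.mem_ofPred_eq, truncMul_neg, Finset.sum_neg_distrib]
      exact le_abs.1 hω
  have hD : (p + p ^ 2) / T ^ 2 * (∑ i, b i ^ 2) * W ≤ (1 + p) * (2 / 3) := by
    have : (p + p ^ 2) / T ^ 2 * (∑ i, b i ^ 2) * W =
      (1 + p) / 3 * (3 * p * W * ∑ i, b i ^ 2) / T ^ 2 := by ring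
    rw [this, div_le_iff₀ (by positivity)]
    calc _ ≤ (1 + p) / 3 * (2 * T ^ 2) := by gcongr
      _ = _ := by ring
  -- The exponent is at most `2(1+p)/3 - 3p`, and this is `≤ -p - 2` exactly when `p ≥ 2`. The two
  -- one-sided tails and the large summands each receive a third of `exp(-p)`.
  have hside : Real.exp ((p + p ^ 2) / T ^ 2 * (∑ i, b i ^ 2) * W - p / T * (3 * T)) ≤
      Real.exp (-p) / 3 := by
    have h1 : Real.exp (-2) ≤ 1 / 3 := by
      have h : Real.exp (-2) = Real.exp (-1) * Real.exp (-1) := by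
        rw [← Real.exp_add]; norm_num
      have := Real.exp_neg_one_lt_d9
      have := Real.exp_pos (-1)
      rw [h]; nlinarith
    calc _ ≤ Real.exp (-p + -2) := by
          apply Real.exp_le_exp.2
          have : p / T * (3 * T) = 3 * p := by field_simp
          linarith
      _ ≤ _ := by
          rw [Real.exp_add]
          nlinarith [Real.exp_pos (-p)]
  have h1 := (measureReal_ge_sum_truncMul_le hξ hind hmean hθ1 (by linarith) hT hρ hb hξint
    hint hW (3 * T)).trans hside
  have h2 : μ.real {ω | 3 * T ≤ ∑ i, truncMul T (-b i) (ξ i ω)} ≤ Real.exp (-p) / 3 := by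
    refine (measureReal_ge_sum_truncMul_le (p := p) (b := fun i => -b i) hξ hind hmean hθ1 (by linarith)
      hT hρ (by simpa using hb) hξint hint hW (3 * T)).trans ?_
    simpa using hside
  have h3 : μ.real (⋃ i, {ω | T < |b i * ξ i ω|}) ≤ Real.exp (-p) / 3 := by
    calc _ ≤ ∑ i, μ.real {ω | T < |b i * ξ i ω|} := measureReal_iUnion_fintype_le _
      _ ≤ ∑ i, Real.exp (-p) / T ^ 2 * b i ^ 2 * W := by
          refine Finset.sum_le_sum fun i _ => ?_
          have hm : MeasurableSet {ω | T < |b i * ξ i ω|} := by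
            have := hξ i
            exact measurableSet_lt measurable_const (by fun_prop)
          rw [← integral_indicator_one hm]
          calc _ ≤ ∫ ω, Real.exp (-p) / T ^ 2 * b i ^ 2 *
                (ξ i ω ^ 2 * Real.exp (ρ * |ξ i ω| ^ θ)) ∂μ := by
                refine integral_mono ((integrable_const (1 : ℝ)).indicator hm)
                  ((hint i).const_mul _) fun ω => ?_
                by_cases h : ω ∈ {ω | T < |b i * ξ i ω|}
                · rw [Set.indicator_of_mem h]
                  exact one_le_of_lt_abs_mul hθ hT (hb i) h hρ
                · rw [Set.indicator_of_notMem h]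
                  positivity
            _ ≤ _ := by
                rw [integral_const_mul]
                have := hW i
                gcongr
      _ = Real.exp (-p) * (3 * p * W * ∑ i, b i ^ 2) / (3 * p * T ^ 2) := by
          rw [← Finset.sum_mul, ← Finset.mul_sum]
          field_simp
      _ ≤ Real.exp (-p) * (2 * T ^ 2) / (3 * p * T ^ 2) := by gcongr
      _ ≤ Real.exp (-p) / 3 := by
          rw [div_le_div_iff₀ (by positivity) (by norm_num)]
          have := mul_le_mul_of_nonneg_left hp (by positivity : 0 ≤ Real.exp (-p) * (3 * T ^ 2))
          linarith
  calc _ ≤ _ := measureReal_mono hsub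
    _ ≤ _ := measureReal_union_le _ _
    _ ≤ _ + (_ + _) := add_le_add_right (measureReal_union_le _ _) _
    _ ≤ Real.exp (-p) := by linarith

end Tail

/-! ### Vector norms and moment estimates for the truncation -/

theorem vecNorm_nonneg {n : ℕ} (q : ℝ) (b : Fin n → ℝ) : 0 ≤ vecNorm q b := by
  unfold vecNorm
  positivity

theorem vecNorm_pos {n : ℕ} (q : ℝ) {b : Fin n → ℝ} (hb : b ≠ 0) : 0 < vecNorm q b := by
  obtain ⟨i, hi⟩ := Function.ne_iff.1 hb
  have hi' : 0 < |b i| := abs_pos.2 hi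
  have : 0 < ∑ i, |b i| ^ q :=
    Finset.sum_pos' (fun j _ => by positivity) ⟨i, Finset.mem_univ i, by positivity⟩
  unfold vecNorm
  positivity

theorem vecNorm_rpow {n : ℕ} {q : ℝ} (hq : q ≠ 0) (b : Fin n → ℝ) :
    vecNorm q b ^ q = ∑ i, |b i| ^ q := by
  unfold vecNorm
  rw [← Real.rpow_mul (Finset.sum_nonneg fun i _ => by positivity), one_div_mul_cancel hq,
    Real.rpow_one]

theorem vecNorm_two_sq {n : ℕ} (b : Fin n → ℝ) : vecNorm 2 b ^ 2 = ∑ i, b i ^ 2 := by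
  have := vecNorm_rpow two_ne_zero b
  simpa using this

/-- The factor `θ^{-1/θ} (1 - 1/θ)^{1/β}` of the Legendre transform of `x ↦ x ^ θ`. -/
noncomputable def youngConst (θ : ℝ) : ℝ := θ ^ (-(1 / θ)) * (1 - θ⁻¹) ^ (1 / conj θ)

theorem youngConst_pos {θ : ℝ} (hθ : 1 < θ) : 0 < youngConst θ := by
  have h0 : 0 < θ := by linarith
  have : 0 < 1 - θ⁻¹ := by
    have := inv_lt_one_of_one_lt₀ hθ
    linarith
  unfold youngConst
  positivity

theorem integrable_of_integrable_exp_rpow {Ω : Type*} [MeasurableSpace Ω] {μ : Measure Ω} {ξ : Ω → ℝ}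
    (hξ : Measurable ξ) {θ : ℝ} (hθ : 0 < θ)
    (hint : Integrable (fun ω => Real.exp (|ξ ω| ^ θ)) μ) : Integrable ξ μ := by
  refine (hint.const_mul ((1 / θ / (Real.exp 1 * 1)) ^ (1 / θ))).mono' hξ.aestronglyMeasurable
    (Filter.Eventually.of_forall fun ω => ?_)
  have h := rpow_le_mul_exp (r := 1 / θ) (a := 1) (y := |ξ ω| ^ θ) (by positivity) one_pos
    (by positivity)
  rwa [← Real.rpow_mul (abs_nonneg _), mul_one_div_cancel hθ.ne', Real.rpow_one,
    one_mul] at h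

/-- The factor `x²` is paid for with the rate `exp(-(3θ))` set aside from the exponent; raised to
the power `-2/θ`, it costs only `e^6`, whatever `θ` is. -/
theorem sq_mul_exp_rpow_le {θ : ℝ} (hθ : 0 < θ) (x : ℝ) :
    x ^ 2 * Real.exp ((1 - Real.exp (-(3 * θ))) * |x| ^ θ) ≤
      Real.exp 6 * ((2 / (Real.exp 1 * θ)) ^ (1 / θ)) ^ 2 * Real.exp (|x| ^ θ) := by
  have h := rpow_le_mul_exp (r := 2 / θ) (a := Real.exp (-(3 * θ))) (y := |x| ^ θ)
    (by positivity) (Real.exp_pos _) (by positivity)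
  have e1 : (|x| ^ θ) ^ (2 / θ) = x ^ 2 := by
    rw [← Real.rpow_mul (abs_nonneg _), mul_div_cancel₀ _ hθ.ne', ← sq_abs, Real.rpow_two]
  have e2 : (2 / θ / (Real.exp 1 * Real.exp (-(3 * θ)))) ^ (2 / θ) =
      Real.exp 6 * ((2 / (Real.exp 1 * θ)) ^ (1 / θ)) ^ 2 := by
    have : 2 / θ / (Real.exp 1 * Real.exp (-(3 * θ))) =
        Real.exp (3 * θ) * (2 / (Real.exp 1 * θ)) := by
      rw [Real.exp_neg]
      field_simp
    rw [this, Real.mul_rpow (Real.exp_nonneg _) (by positivity), ← Real.exp_mul,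
      ← Real.rpow_mul_natCast (by positivity)]
    congr 2
    · field_simp
      norm_num
    · push_cast
      ring
  rw [e1, e2] at h
  calc _ ≤ Real.exp 6 * ((2 / (Real.exp 1 * θ)) ^ (1 / θ)) ^ 2 *
        Real.exp (Real.exp (-(3 * θ)) * |x| ^ θ) *
          Real.exp ((1 - Real.exp (-(3 * θ))) * |x| ^ θ) := by gcongr
    _ = _ := by
      rw [mul_assoc, ← Real.exp_add]
      ring_nf

/-- The truncation level admits the exponential moment of order `1 - exp (-3 θ)`. -/
theorem one_le_truncation_rate {θ : ℝ} (hθ : 0 < θ) (hθ1 : θ ≤ 1) :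
    1 ≤ (1 - Real.exp (-(3 * θ))) *
      (Real.exp 4 * 3 ^ ((2 - θ) / (3 * θ)) * (Real.exp 1 * θ) ^ (-(1 / θ)) / 3) ^ θ := by
  have e3 : Real.exp (Real.log 3) = 3 := Real.exp_log (by norm_num)
  have hlog : 1 ≤ Real.log 3 := by
    rw [Real.le_log_iff_exp_le (by norm_num)]
    have := Real.exp_one_lt_d9
    linarith
  have h1 : 3 * θ * Real.exp (-(3 * θ)) ≤ 1 - Real.exp (-(3 * θ)) := by
    have h := Real.add_one_le_exp (3 * θ)
    have h2 : Real.exp (3 * θ) * Real.exp (-(3 * θ)) = 1 := by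
      rw [← Real.exp_add, add_neg_cancel, Real.exp_zero]
    nlinarith [Real.exp_pos (-(3 * θ))]
  have e1 : (Real.exp 4 * 3 ^ ((2 - θ) / (3 * θ)) * (Real.exp 1 * θ) ^ (-(1 / θ)) / 3) ^ θ =
      Real.exp (4 * θ - 1 + Real.log 3 * (2 / 3 - 4 / 3 * θ)) / θ := by
    rw [Real.div_rpow (by positivity) (by norm_num), Real.mul_rpow (by positivity) (by positivity),
      Real.mul_rpow (by positivity) (by positivity), ← Real.rpow_mul (by norm_num),
      ← Real.rpow_mul (by positivity), ← Real.exp_mul]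
    have e4 : (2 - θ) / (3 * θ) * θ = 2 / 3 - θ / 3 := by field_simp
    have e5 : -(1 / θ) * θ = -1 := by field_simp
    rw [e4, e5, Real.rpow_neg_one, Real.rpow_def_of_pos (by norm_num),
      Real.rpow_def_of_pos (by norm_num), mul_inv, ← Real.exp_neg, ← mul_assoc, ← Real.exp_add,
      ← Real.exp_add, mul_div_right_comm, ← Real.exp_sub, div_eq_mul_inv]
    ring_nf
  rw [e1]
  -- By `1 - e^{-3θ} ≥ 3θ e^{-3θ}` the factor `1/θ` cancels. The remaining exponent is `(5/3 - 4θ/3)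
  -- log 3 + θ - 1`, nonnegative on `(0,1]` because `log 3 ≥ 1`.
  calc (1 : ℝ) ≤ Real.exp (Real.log 3 + θ - 1 + Real.log 3 * (2 / 3 - 4 / 3 * θ)) := by
        apply Real.one_le_exp
        nlinarith
    _ = 3 * θ * Real.exp (-(3 * θ)) *
        (Real.exp (4 * θ - 1 + Real.log 3 * (2 / 3 - 4 / 3 * θ)) / θ) := by
        rw [show 3 * θ * Real.exp (-(3 * θ)) *
          (Real.exp (4 * θ - 1 + Real.log 3 * (2 / 3 - 4 / 3 * θ)) / θ) =
          3 * (Real.exp (-(3 * θ)) * Real.exp (4 * θ - 1 + Real.log 3 * (2 / 3 - 4 / 3 * θ))) by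
            field_simp, ← Real.exp_add]
        calc _ = Real.exp (Real.log 3 +
              (-(3 * θ) + (4 * θ - 1 + Real.log 3 * (2 / 3 - 4 / 3 * θ)))) := by ring_nf
          _ = _ := by rw [Real.exp_add, e3]
    _ ≤ _ := by gcongr

/-! ### Tails of normalized sums for θ ≤ 1 and for θ > 1 -/

section Tail

variable {Ω : Type*} [MeasurableSpace Ω] {μ : Measure Ω} [IsProbabilityMeasure μ] {n : ℕ}

/-- The tail of a weighted sum of independent centred sub-Weibull variables, `θ ≤ 1`. -/
theorem measureReal_abs_sum_ge_le_of_le_one {ξ : Fin n → Ω → ℝ} (hξ : ∀ i, Measurable (ξ i))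
    (hind : iIndepFun ξ μ) (hmean : ∀ i, ∫ ω, ξ i ω ∂μ = 0) {θ p s : ℝ} {b : Fin n → ℝ}
    (hθ : 0 < θ) (hθ1 : θ ≤ 1) (hp : 2 ≤ p)
    (hint : ∀ i, Integrable (fun ω => Real.exp (|ξ i ω| ^ θ)) μ)
    (hE : ∀ i, ∫ ω, Real.exp (|ξ i ω| ^ θ) ∂μ ≤ 2) (hs : 0 < s)
    (h : 2 * Real.exp 4 * (2 / (Real.exp 1 * θ)) ^ (1 / θ) * vecNorm 2 b * √p +
      Real.exp 4 * 3 ^ ((2 - θ) / (3 * θ)) * (Real.exp 1 * θ) ^ (-(1 / θ)) * ‖b‖ * p ^ (1 / θ)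
      ≤ s) :
    μ.real {ω | s ≤ |∑ i, b i * ξ i ω|} ≤ Real.exp (-p) := by
  have hD := vecNorm_nonneg 2 b
  set v : ℝ := (2 / (Real.exp 1 * θ)) ^ (1 / θ) with hv
  set c : ℝ := Real.exp 4 * 3 ^ ((2 - θ) / (3 * θ)) * (Real.exp 1 * θ) ^ (-(1 / θ)) with hc
  have hv0 : 0 < v := by positivity
  have hc0 : 0 < c := by positivity
  have hρ : 0 ≤ 1 - Real.exp (-(3 * θ)) := by
    have : Real.exp (-(3 * θ)) ≤ 1 := Real.exp_le_one_iff.2 (by linarith)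
    linarith
  have hs1 : 2 * Real.exp 4 * v * vecNorm 2 b * √p ≤ s := by
    have : 0 ≤ c * ‖b‖ * p ^ (1 / θ) := by positivity
    linarith
  have hs2 : c * ‖b‖ * p ^ (1 / θ) ≤ s := by
    have : 0 ≤ 2 * Real.exp 4 * v * vecNorm 2 b * √p := by positivity
    linarith
  have hm : ∀ i, Measurable fun ω => ξ i ω ^ 2 *
      Real.exp ((1 - Real.exp (-(3 * θ))) * |ξ i ω| ^ θ) := fun i => by
    have := hξ i
    fun_prop
  have hWint : ∀ i, Integrable (fun ω => ξ i ω ^ 2 *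
      Real.exp ((1 - Real.exp (-(3 * θ))) * |ξ i ω| ^ θ)) μ := fun i =>
    ((hint i).const_mul (Real.exp 6 * v ^ 2)).mono' (hm i).aestronglyMeasurable
      (Filter.Eventually.of_forall fun ω => by
        rw [Real.norm_eq_abs, abs_of_nonneg (by positivity)]
        exact sq_mul_exp_rpow_le hθ _)
  have hW : ∀ i, ∫ ω, ξ i ω ^ 2 * Real.exp ((1 - Real.exp (-(3 * θ))) * |ξ i ω| ^ θ) ∂μ ≤
      Real.exp 6 * v ^ 2 * 2 := fun i => by
    calc _ ≤ ∫ ω, Real.exp 6 * v ^ 2 * Real.exp (|ξ i ω| ^ θ) ∂μ :=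
          integral_mono (hWint i) ((hint i).const_mul _) fun ω => sq_mul_exp_rpow_le hθ _
      _ ≤ _ := by
        rw [integral_const_mul]
        have := hE i
        gcongr
  have key := measureReal_abs_sum_ge_le_of_truncation hξ hind hmean (b := b) hθ hθ1 hp
    (T := s / 3) (by positivity) hρ (fun i => ?_)
    (fun i => integrable_of_integrable_exp_rpow (hξ i) hθ (hint i)) hWint hW ?_
  · rwa [mul_div_cancel₀ _ three_ne_zero] at key
  · have h1 : c / 3 * |b i| * p ^ (1 / θ) ≤ s / 3 := by
      have : c * |b i| * p ^ (1 / θ) ≤ c * ‖b‖ * p ^ (1 / θ) := by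
        have : |b i| ≤ ‖b‖ := norm_le_pi_norm b i
        gcongr
      linarith
    have h2 : (c / 3) ^ θ * |b i| ^ θ * p ≤ (s / 3) ^ θ := by
      calc _ = (c / 3 * |b i| * p ^ (1 / θ)) ^ θ := by
            rw [Real.mul_rpow (by positivity) (by positivity),
              Real.mul_rpow (by positivity) (by positivity), ← Real.rpow_mul (by positivity),
              one_div_mul_cancel hθ.ne', Real.rpow_one]
        _ ≤ _ := by gcongr
    calc p * |b i| ^ θ = 1 * (p * |b i| ^ θ) := by ring
      _ ≤ ((1 - Real.exp (-(3 * θ))) * (c / 3) ^ θ) * (p * |b i| ^ θ) := by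
          have := one_le_truncation_rate hθ hθ1
          gcongr
      _ = (1 - Real.exp (-(3 * θ))) * ((c / 3) ^ θ * |b i| ^ θ * p) := by ring
      _ ≤ _ := by gcongr
  · rw [← vecNorm_two_sq]
    have h1 : (2 * Real.exp 4 * v * vecNorm 2 b * √p) ^ 2 ≤ s ^ 2 := by gcongr
    have h2 : Real.exp 4 ^ 2 = Real.exp 6 * Real.exp 1 ^ 2 := by
      rw [← Real.exp_nat_mul, ← Real.exp_nat_mul, ← Real.exp_add]
      norm_num
    -- With `W = 2 e^6 v²` and `T = s/3`, the variance condition of the truncation reduces to `6 ≤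
    -- (8/9) e²`.
    have h3 : (27 : ℝ) / 4 ≤ Real.exp 1 ^ 2 := by
      have := Real.exp_one_gt_d9
      nlinarith
    have h4 : (2 * Real.exp 4 * v * vecNorm 2 b * √p) ^ 2 =
        4 * (Real.exp 6 * v ^ 2 * vecNorm 2 b ^ 2 * p) * Real.exp 1 ^ 2 := by
      rw [mul_pow, mul_pow, mul_pow, mul_pow, Real.sq_sqrt (by linarith), h2]
      ring
    have h5 : 0 ≤ 4 * (Real.exp 6 * v ^ 2 * vecNorm 2 b ^ 2 * p) := by positivity
    have h6 := mul_le_mul_of_nonneg_left h3 h5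
    rw [h4] at h1
    have e : 2 * (s / 3) ^ 2 = 2 / 9 * s ^ 2 := by ring
    rw [e]
    linarith

/-- The moment generating function of a centred sub-Weibull variable, `θ > 1`. -/
theorem integral_exp_mul_le_of_one_lt {ξ : Ω → ℝ} (hξ : Measurable ξ)
    (hmean : ∫ ω, ξ ω ∂μ = 0) {θ : ℝ} (hθ : 1 < θ)
    (hint : Integrable (fun ω => Real.exp (|ξ ω| ^ θ)) μ)
    (hE : ∫ ω, Real.exp (|ξ ω| ^ θ) ∂μ ≤ 2) (y : ℝ) :
    Integrable (fun ω => Real.exp (y * ξ ω)) μ ∧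
      ∫ ω, Real.exp (y * ξ ω) ∂μ ≤
        Real.exp (8 * Real.exp 1 * y ^ 2 + youngConst θ ^ conj θ * |y| ^ conj θ) := by
  set k := youngConst θ ^ conj θ * |y| ^ conj θ with hk
  have hk0 : 0 ≤ k := by
    have := youngConst_pos hθ
    positivity
  have hle : ∀ ω, Real.exp (y * ξ ω) ≤ Real.exp k * Real.exp (|ξ ω| ^ θ) := fun ω => by
    rw [← Real.exp_add]
    apply Real.exp_le_exp.2
    have h := mul_le_rpow_add_rpow hθ (abs_nonneg (ξ ω)) (abs_nonneg y)
    have h2 := le_abs_self (y * ξ ω)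
    rw [abs_mul] at h2
    change _ ≤ _ + youngConst θ ^ conj θ * |y| ^ conj θ at h
    linarith
  have hI : Integrable (fun ω => Real.exp (y * ξ ω)) μ :=
    (hint.const_mul (Real.exp k)).mono' (by fun_prop) (Filter.Eventually.of_forall fun ω => by
      rw [Real.norm_eq_abs, Real.abs_exp]
      exact hle ω)
  have he := Real.exp_one_gt_d9
  refine ⟨hI, ?_⟩
  -- For `|y| ≤ 1/2` the quadratic remainder is at most `4y² e^{|x|}`, and `|x| ≤ 1 + |x|^θ`. For
  -- larger `|y|`, Young's inequality leaves a factor `2 ≤ e`, which `8e y² ≥ 2e` absorbs.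
  by_cases hy : |y| ≤ 1 / 2
  · have hξI := integrable_of_integrable_exp_rpow hξ (by linarith : 0 < θ) hint
    have hpt : ∀ x : ℝ, Real.exp (y * x) ≤
        1 + y * x + 4 * Real.exp 1 * y ^ 2 * Real.exp (|x| ^ θ) := fun x => by
      have h1 := exp_le_one_add_add_sq_mul_exp_abs (y * x)
      have h2 : |y * x| ≤ |x| / 2 := by
        rw [abs_mul]
        nlinarith [abs_nonneg x]
      have h3 : x ^ 2 ≤ 4 * Real.exp (|x| / 2) := by
        have h4 : |x| / 4 ≤ Real.exp (|x| / 4 - 1) := by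
          have := Real.add_one_le_exp (|x| / 4 - 1)
          linarith
        have h5 : Real.exp (|x| / 4) = Real.exp (|x| / 4 - 1) * Real.exp 1 := by
          rw [← Real.exp_add, sub_add_cancel]
        have h6 : |x| / 2 ≤ Real.exp (|x| / 4) := by
          rw [h5]
          nlinarith [abs_nonneg x]
        have h7 : Real.exp (|x| / 2) = Real.exp (|x| / 4) ^ 2 := by
          rw [← Real.exp_nat_mul]
          ring_nf
        have h8 : (|x| / 2) ^ 2 ≤ Real.exp (|x| / 4) ^ 2 := by gcongr
        rw [h7]
        rw [div_pow, sq_abs] at h8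
        linarith
      have h4 : |x| ≤ 1 + |x| ^ θ := by
        rcases le_total |x| 1 with h | h
        · have : 0 ≤ |x| ^ θ := by positivity
          linarith
        · have := Real.self_le_rpow_of_one_le h hθ.le
          linarith
      calc _ ≤ 1 + y * x + (y * x) ^ 2 * Real.exp |y * x| := h1
        _ ≤ 1 + y * x + y ^ 2 * (4 * Real.exp (|x| / 2)) * Real.exp (|x| / 2) := by
          rw [mul_pow]
          gcongr
        _ = 1 + y * x + 4 * y ^ 2 * Real.exp |x| := by
          have : Real.exp |x| = Real.exp (|x| / 2) * Real.exp (|x| / 2) := by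
            rw [← Real.exp_add, add_halves]
          rw [this]
          ring
        _ ≤ 1 + y * x + 4 * y ^ 2 * Real.exp (1 + |x| ^ θ) := by gcongr
        _ = _ := by
          rw [Real.exp_add]
          ring
    have hL : Integrable (fun ω => 1 + y * ξ ω) μ :=
      (integrable_const _).add (hξI.const_mul _)
    calc _ ≤ ∫ ω, 1 + y * ξ ω + 4 * Real.exp 1 * y ^ 2 * Real.exp (|ξ ω| ^ θ) ∂μ :=
          integral_mono hI (hL.add (hint.const_mul _)) fun ω => hpt _
      _ = 1 + 4 * Real.exp 1 * y ^ 2 * ∫ ω, Real.exp (|ξ ω| ^ θ) ∂μ := by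
          rw [integral_add hL (hint.const_mul _), integral_add (integrable_const _)
            (hξI.const_mul _), integral_const_mul, integral_const_mul, hmean]
          simp
      _ ≤ 1 + 4 * Real.exp 1 * y ^ 2 * 2 := by gcongr
      _ ≤ Real.exp (8 * Real.exp 1 * y ^ 2) := by
          have := Real.add_one_le_exp (8 * Real.exp 1 * y ^ 2)
          linarith
      _ ≤ _ := Real.exp_le_exp.2 (by linarith)
  · push Not at hy
    calc _ ≤ ∫ ω, Real.exp k * Real.exp (|ξ ω| ^ θ) ∂μ :=
          integral_mono hI (hint.const_mul _) hle
      _ ≤ Real.exp k * 2 := by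
          rw [integral_const_mul]
          gcongr
      _ ≤ Real.exp k * Real.exp 1 := by
          gcongr
          linarith
      _ ≤ _ := by
          rw [← Real.exp_add]
          apply Real.exp_le_exp.2
          have h1 : (1 : ℝ) / 4 ≤ y ^ 2 := by
            rw [← sq_abs]
            nlinarith
          nlinarith

/-- The tail of a weighted sum of independent centred sub-Weibull variables, `θ > 1`. -/
theorem measureReal_abs_sum_ge_le_of_one_lt {ξ : Fin n → Ω → ℝ} (hξ : ∀ i, Measurable (ξ i))
    (hind : iIndepFun ξ μ) (hmean : ∀ i, ∫ ω, ξ i ω ∂μ = 0) {θ p s : ℝ} {b : Fin n → ℝ}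
    (hθ : 1 < θ) (hp : 2 ≤ p) (hb : b ≠ 0)
    (hint : ∀ i, Integrable (fun ω => Real.exp (|ξ i ω| ^ θ)) μ)
    (hE : ∀ i, ∫ ω, Real.exp (|ξ i ω| ^ θ) ∂μ ≤ 2)
    (h : 4 * Real.exp 1 ^ 2 * vecNorm 2 b * √p +
      4 * Real.exp 1 ^ 2 * youngConst θ * vecNorm (conj θ) b * p ^ (1 / θ) ≤ s) :
    μ.real {ω | s ≤ |∑ i, b i * ξ i ω|} ≤ Real.exp (-p) := by
  have hc : θ.HolderConjugate (conj θ) := Real.HolderConjugate.conjExponent hθ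
  have hcpos : 0 < conj θ := hc.symm.pos
  have hD := vecNorm_pos 2 hb
  have hN := vecNorm_pos (conj θ) hb
  have hκ := youngConst_pos hθ
  have hp0 : 0 < p := by linarith
  set D := vecNorm 2 b with hDdef
  set N := vecNorm (conj θ) b with hNdef
  set κ := youngConst θ with hκdef
  -- The largest rate at which both the Gaussian term `(lD)²` and the term `(lκN)^β` stay below `p`.
  -- Whichever bound attains the minimum, the matching part of `s` alone gives `l * s ≥ 4e² p`.
  set l : ℝ := min (√p / D) (p ^ (1 / conj θ) / (κ * N)) with hl
  have hl0 : 0 < l := lt_min (by positivity) (by positivity)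
  have hl1 : l * D ≤ √p := by
    rw [← le_div_iff₀ hD]
    exact min_le_left _ _
  have hl2 : l * (κ * N) ≤ p ^ (1 / conj θ) := by
    rw [← le_div_iff₀ (by positivity)]
    exact min_le_right _ _
  have hpp : √p * √p = p := Real.mul_self_sqrt hp0.le
  have hpc : p ^ (1 / θ) * p ^ (1 / conj θ) = p := by
    rw [← Real.rpow_add hp0, one_div, one_div, hc.inv_add_inv_eq_one, Real.rpow_one]
  have hls : 4 * Real.exp 1 ^ 2 * p ≤ l * s := by
    have h1 : 4 * Real.exp 1 ^ 2 * p ≤ l * (4 * Real.exp 1 ^ 2 * D * √p +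
        4 * Real.exp 1 ^ 2 * κ * N * p ^ (1 / θ)) := by
      rcases min_choice (√p / D) (p ^ (1 / conj θ) / (κ * N)) with hm | hm
      · have h2 : l * D = √p := by rw [hl, hm]; field_simp
        have h3 : 0 ≤ l * (4 * Real.exp 1 ^ 2 * κ * N * p ^ (1 / θ)) := by positivity
        calc 4 * Real.exp 1 ^ 2 * p = 4 * Real.exp 1 ^ 2 * (l * D * √p) := by rw [h2, hpp]
          _ ≤ _ := by linarith
      · have h2 : l * (κ * N) = p ^ (1 / conj θ) := by rw [hl, hm]; field_simp
        have h3 : 0 ≤ l * (4 * Real.exp 1 ^ 2 * D * √p) := by positivity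
        calc 4 * Real.exp 1 ^ 2 * p = 4 * Real.exp 1 ^ 2 * (p ^ (1 / θ) * (l * (κ * N))) := by
              rw [h2, hpc]
          _ ≤ _ := by linarith
    exact h1.trans (by gcongr)
  have hsum : ∑ i, (8 * Real.exp 1 * (l * b i) ^ 2 + κ ^ conj θ * |l * b i| ^ conj θ) ≤
      8 * Real.exp 1 * p + p := by
    have e1 : ∑ i, (8 * Real.exp 1 * (l * b i) ^ 2 + κ ^ conj θ * |l * b i| ^ conj θ) =
        8 * Real.exp 1 * (l * D) ^ 2 + (l * (κ * N)) ^ conj θ := by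
      rw [Real.mul_rpow hl0.le (by positivity), Real.mul_rpow hκ.le hN.le, hNdef,
        vecNorm_rpow hcpos.ne', mul_pow, hDdef, vecNorm_two_sq, Finset.sum_add_distrib,
        Finset.mul_sum, Finset.mul_sum, Finset.mul_sum, Finset.mul_sum]
      congr 1
      · exact Finset.sum_congr rfl fun i _ => by ring
      · refine Finset.sum_congr rfl fun i _ => ?_
        rw [abs_mul, abs_of_pos hl0, Real.mul_rpow hl0.le (abs_nonneg _)]
        ring
    have e2 : (p ^ (1 / conj θ)) ^ conj θ = p := by
      rw [← Real.rpow_mul hp0.le, one_div_mul_cancel hcpos.ne', Real.rpow_one]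
    have e3 : √p ^ 2 = p := Real.sq_sqrt hp0.le
    rw [e1]
    calc _ ≤ 8 * Real.exp 1 * √p ^ 2 + (p ^ (1 / conj θ)) ^ conj θ := by gcongr
      _ = _ := by rw [e2, e3]
  have hbound : ∀ b' : Fin n → ℝ, (∀ i, |b' i| = |b i|) →
      μ.real {ω | s ≤ ∑ i, b' i * ξ i ω} ≤ Real.exp (-p) / 2 := by
    intro b' hb'
    have e : ∀ i ω, l * (b' i * ξ i ω) = l * b' i * ξ i ω := fun i ω => by ring
    have hm := fun i => integral_exp_mul_le_of_one_lt (hξ i) (hmean i) hθ (hint i) (hE i)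
      (l * b' i)
    have h1 := measureReal_ge_sum_le_exp (μ := μ) (V := fun i ω => b' i * ξ i ω) (l := l)
      (a := fun i => 8 * Real.exp 1 * (l * b' i) ^ 2 + κ ^ conj θ * |l * b' i| ^ conj θ)
      (fun i => (hξ i).const_mul _)
      (hind.comp (fun i x => b' i * x) fun i => measurable_const_mul _) hl0.le
      (fun i => by simpa only [e] using (hm i).1) (fun i => by simpa only [e] using (hm i).2) s
    have h2 : ∑ i, (8 * Real.exp 1 * (l * b' i) ^ 2 + κ ^ conj θ * |l * b' i| ^ conj θ) =
        ∑ i, (8 * Real.exp 1 * (l * b i) ^ 2 + κ ^ conj θ * |l * b i| ^ conj θ) :=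
      Finset.sum_congr rfl fun i _ => by
        rw [← sq_abs (l * b' i), ← sq_abs (l * b i), abs_mul, abs_mul, hb']
    have he1 := Real.exp_one_gt_d9
    refine h1.trans ?_
    rw [h2]
    -- Since `4e² ≥ 8e + 3`, the exponent is at most `-2p ≤ -p - 1`; then `e^{-1} < 1/2` leaves room
    -- for the two signs.
    calc _ ≤ Real.exp (-p + -1) := by
          apply Real.exp_le_exp.2
          have : 0 ≤ (4 * Real.exp 1 ^ 2 - 8 * Real.exp 1 - 3) * p := by
            apply mul_nonneg _ hp0.le
            nlinarith
          linarith
      _ ≤ _ := by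
          rw [Real.exp_add]
          have := Real.exp_neg_one_lt_d9
          nlinarith [Real.exp_pos (-p)]
  have hsub : {ω | s ≤ |∑ i, b i * ξ i ω|} ⊆
      {ω | s ≤ ∑ i, b i * ξ i ω} ∪ {ω | s ≤ ∑ i, -b i * ξ i ω} := by
    intro ω hω
    simpa only [Set.mem_union, Set.mem_ofPred_eq, neg_mul, Finset.sum_neg_distrib] using
      le_abs.1 hω
  calc _ ≤ _ := measureReal_mono hsub
    _ ≤ _ := measureReal_union_le _ _
    _ ≤ Real.exp (-p) / 2 + Real.exp (-p) / 2 :=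
      add_le_add (hbound b fun _ => rfl) (hbound (fun i => -b i) fun _ => abs_neg _)
    _ = _ := add_halves _

end Tail

/-! ### Normalization by the sub-Weibull norm -/

section Normalization

variable {Ω : Type*} [MeasurableSpace Ω] {μ : Measure Ω}

theorem lintegral_exp_le_of_psiNorm_lt {θ c : ℝ} (hθ : 0 < θ) {X : Ω → ℝ}
    (h : psiNorm μ θ X < ENNReal.ofReal c) :
    ∫⁻ ω, ENNReal.ofReal (Real.exp (|X ω| ^ θ / c ^ θ)) ∂μ ≤ 2 := by
  obtain ⟨_, ⟨c', ⟨hc', hle⟩, rfl⟩, hlt⟩ := sInf_lt_iff.1 h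
  have hcc : c' < c := ENNReal.ofReal_lt_ofReal_iff'.1 hlt |>.1
  refine le_trans (lintegral_mono fun ω => ?_) hle
  gcongr

/-- The infimum in the definition of a positive sub-Weibull norm is attained. -/
theorem lintegral_exp_div_psiNorm_le {θ : ℝ} (hθ : 0 < θ) {X : Ω → ℝ} (hX : Measurable X)
    (hfin : psiNorm μ θ X < ∞) (hpos : 0 < (psiNorm μ θ X).toReal) :
    ∫⁻ ω, ENNReal.ofReal (Real.exp (|X ω| ^ θ / (psiNorm μ θ X).toReal ^ θ)) ∂μ ≤ 2 := by
  set ν := (psiNorm μ θ X).toReal with hν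
  -- Every level above the norm is admissible; Fatou's lemma along levels decreasing to the norm
  -- transfers the bound to the norm itself.
  set c : ℕ → ℝ := fun k => ν + 1 / ((k : ℝ) + 1) with hc
  have hclim : Filter.Tendsto c Filter.atTop (nhds ν) := by
    simpa [hc] using (tendsto_one_div_add_atTop_nhds_zero_nat (𝕜 := ℝ)).const_add ν
  have hle : ∀ k, ∫⁻ ω, ENNReal.ofReal (Real.exp (|X ω| ^ θ / c k ^ θ)) ∂μ ≤ 2 := fun k => by
    refine lintegral_exp_le_of_psiNorm_lt hθ ?_
    rw [← ENNReal.ofReal_toReal hfin.ne, ← hν]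
    have hk : (0 : ℝ) < 1 / ((k : ℝ) + 1) := by positivity
    exact (ENNReal.ofReal_lt_ofReal_iff (by simp only [hc]; linarith)).2 (by simp only [hc]; linarith)
  have hlim : ∀ ω, Filter.Tendsto (fun k => ENNReal.ofReal (Real.exp (|X ω| ^ θ / c k ^ θ)))
      Filter.atTop (nhds (ENNReal.ofReal (Real.exp (|X ω| ^ θ / ν ^ θ)))) := fun ω => by
    refine ENNReal.tendsto_ofReal (Real.continuous_exp.continuousAt.tendsto.comp ?_)
    exact tendsto_const_nhds.div (hclim.rpow_const (Or.inl hpos.ne')) (by positivity)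
  calc _ = ∫⁻ ω, Filter.liminf (fun k => ENNReal.ofReal (Real.exp (|X ω| ^ θ / c k ^ θ)))
        Filter.atTop ∂μ := lintegral_congr fun ω => (hlim ω).liminf_eq.symm
    _ ≤ Filter.liminf (fun k => ∫⁻ ω, ENNReal.ofReal (Real.exp (|X ω| ^ θ / c k ^ θ)) ∂μ)
        Filter.atTop := lintegral_liminf_le fun k => by fun_prop
    _ ≤ Filter.liminf (fun _ : ℕ => (2 : ℝ≥0∞)) Filter.atTop :=
        Filter.liminf_le_liminf (Filter.Eventually.of_forall hle)
    _ = 2 := by simp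

/-- Every level `c = ε^{1/θ}` is admissible, and `u ≤ e^u` turns this into `E|X|^θ ≤ 2ε`. -/
theorem ae_eq_zero_of_psiNorm_eq_zero {θ : ℝ} (hθ : 0 < θ) {X : Ω → ℝ} (hX : Measurable X)
    (h0 : psiNorm μ θ X = 0) : ∀ᵐ ω ∂μ, X ω = 0 := by
  have hle : ∀ ε : NNReal, 0 < ε → ∫⁻ ω, ENNReal.ofReal (|X ω| ^ θ) ∂μ ≤ 2 * (ε : ℝ≥0∞) := by
    intro ε hε
    have hε' : (0 : ℝ) < ε := hε
    have h := lintegral_exp_le_of_psiNorm_lt (μ := μ) (X := X) (c := (ε : ℝ) ^ (1 / θ)) hθ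
      (by rw [h0]; exact ENNReal.ofReal_pos.2 (by positivity))
    rw [← Real.rpow_mul hε'.le, one_div_mul_cancel hθ.ne', Real.rpow_one] at h
    calc _ ≤ ∫⁻ ω, ENNReal.ofReal (Real.exp (|X ω| ^ θ / ε)) * ε ∂μ := by
          refine lintegral_mono fun ω => ?_
          rw [← ENNReal.ofReal_coe_nnreal, ← ENNReal.ofReal_mul (Real.exp_nonneg _)]
          apply ENNReal.ofReal_le_ofReal
          rw [← div_le_iff₀ hε']
          linarith [Real.add_one_le_exp (|X ω| ^ θ / ε)]
      _ = (∫⁻ ω, ENNReal.ofReal (Real.exp (|X ω| ^ θ / ε)) ∂μ) * ε :=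
          lintegral_mul_const _ (by fun_prop)
      _ ≤ _ := by gcongr
  have hz : ∫⁻ ω, ENNReal.ofReal (|X ω| ^ θ) ∂μ = 0 := by
    refine le_antisymm (ENNReal.le_of_forall_pos_le_add fun ε hε _ => ?_) (zero_le)
    rw [zero_add]
    refine (hle (ε / 2) (by positivity)).trans_eq ?_
    rw [ENNReal.coe_div two_ne_zero, ENNReal.coe_ofNat,
      ENNReal.mul_div_cancel two_ne_zero ENNReal.ofNat_ne_top]
  rw [lintegral_eq_zero_iff (by fun_prop)] at hz
  filter_upwards [hz] with ω hω
  have h1 : |X ω| ^ θ = 0 :=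
    le_antisymm (ENNReal.ofReal_eq_zero.1 hω) (by positivity)
  exact abs_eq_zero.1 ((Real.rpow_eq_zero (abs_nonneg _) hθ.ne').1 h1)

/-- Division by the sub-Weibull norm, with value `0` where the norm vanishes. -/
noncomputable def normalized (μ : Measure Ω) (θ : ℝ) (X : Ω → ℝ) : Ω → ℝ :=
  fun ω => X ω / (psiNorm μ θ X).toReal

theorem normalized_mul_psiNorm {θ : ℝ} (hθ : 0 < θ) {X : Ω → ℝ} (hX : Measurable X)
    (hfin : psiNorm μ θ X < ∞) :
    ∀ᵐ ω ∂μ, (psiNorm μ θ X).toReal * normalized μ θ X ω = X ω := by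
  unfold normalized
  by_cases h : (psiNorm μ θ X).toReal = 0
  · have h0 : psiNorm μ θ X = 0 := ((ENNReal.toReal_eq_zero_iff _).1 h).resolve_right hfin.ne
    filter_upwards [ae_eq_zero_of_psiNorm_eq_zero hθ hX h0] with ω hω
    simp [hω]
  · exact Filter.Eventually.of_forall fun ω => mul_div_cancel₀ _ h

theorem normalized_exp_moment [IsProbabilityMeasure μ] {θ : ℝ} (hθ : 0 < θ) {X : Ω → ℝ}
    (hX : Measurable X) (hfin : psiNorm μ θ X < ∞) :
    Integrable (fun ω => Real.exp (|normalized μ θ X ω| ^ θ)) μ ∧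
      ∫ ω, Real.exp (|normalized μ θ X ω| ^ θ) ∂μ ≤ 2 := by
  have hle : ∫⁻ ω, ENNReal.ofReal (Real.exp (|normalized μ θ X ω| ^ θ)) ∂μ ≤ 2 := by
    unfold normalized
    rcases (ENNReal.toReal_nonneg (a := psiNorm μ θ X)).eq_or_lt with h | h
    -- At norm zero, division by zero makes the normalized variable 0, with exponential moment 1.
    · simp [← h, hθ.ne']
    · refine le_trans (le_of_eq (lintegral_congr fun ω => ?_))
        (lintegral_exp_div_psiNorm_le hθ hX hfin h)
      rw [abs_div, abs_of_pos h, Real.div_rpow (abs_nonneg _) h.le]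
  have hm : Measurable fun ω => Real.exp (|normalized μ θ X ω| ^ θ) := by
    unfold normalized
    fun_prop
  have hnn : 0 ≤ᵐ[μ] fun ω => Real.exp (|normalized μ θ X ω| ^ θ) :=
    Filter.Eventually.of_forall fun ω => Real.exp_nonneg _
  refine ⟨⟨hm.aestronglyMeasurable, (hasFiniteIntegral_iff_ofReal hnn).2
    (hle.trans_lt ENNReal.ofNat_lt_top)⟩, ?_⟩
  rw [integral_eq_lintegral_of_nonneg_ae hnn hm.aestronglyMeasurable]
  exact ENNReal.toReal_le_of_le_ofReal (by norm_num) (by simpa using hle)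

end Normalization

/-! ### Lower bounds for the constants -/

/-- Stirling's lower bound at `x = p/θ` makes `p` cancel, so the estimate survives the infimum
defining `constA`. -/
theorem div_exp_rpow_le_gammaTerm {θ p : ℝ} (hθ : 0 < θ) (hp : 0 < p) :
    (Real.exp 1 * θ) ^ (-(1 / θ)) ≤ gammaTerm θ p := by
  have h := Real.rpow_le_rpow (by positivity)
    (div_exp_one_rpow_le_Gamma (x := p / θ) (by positivity)) (by positivity : 0 ≤ 1 / p)
  unfold gammaTerm
  refine le_trans (le_of_eq ?_) (mul_le_mul_of_nonneg_left h (by positivity))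
  rw [← Real.rpow_mul (by positivity), show p / θ * (1 / p) = 1 / θ by field_simp,
    Real.rpow_neg (by positivity), Real.rpow_neg (by positivity), ← Real.inv_rpow (by positivity),
    ← Real.inv_rpow (by positivity), ← Real.mul_rpow (by positivity) (by positivity)]
  congr 1
  field_simp

theorem gammaTerm_nonneg {θ p : ℝ} (hθ : 0 < θ) (hp : 0 < p) : 0 ≤ gammaTerm θ p :=
  le_trans (by positivity) (div_exp_rpow_le_gammaTerm hθ hp)

/-- Only the summand with `Γ(2/θ + 1)` is kept, bounded below by Stirling at `x = 2/θ`; this is the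
coefficient of the Gaussian part of the tail. -/
theorem le_constCLow {θ : ℝ} (hθ : 0 < θ) :
    2 * Real.exp 3 * (2 / (Real.exp 1 * θ)) ^ (1 / θ) ≤ constCLow θ := by
  have h1 : 0 ≤ ⨆ p : Set.Ici (2 : ℝ), gammaTerm θ p :=
    Real.iSup_nonneg fun p => gammaTerm_nonneg hθ (by have : (2 : ℝ) ≤ p := p.2; linarith)
  have h2 : 0 ≤ Real.log 2 ^ (1 / θ) := Real.rpow_nonneg (Real.log_nonneg (by norm_num)) _
  have h3 : (2 / (Real.exp 1 * θ)) ^ (1 / θ) ≤ Real.Gamma (2 / θ + 1) ^ ((1 : ℝ) / 2) := by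
    have h := Real.rpow_le_rpow (by positivity)
      (div_exp_one_rpow_le_Gamma (x := 2 / θ) (by positivity)) (by norm_num : (0 : ℝ) ≤ 1 / 2)
    refine le_trans (le_of_eq ?_) h
    rw [← Real.rpow_mul (by positivity)]
    congr 1 <;> field_simp
  have h4 : 0 ≤ (3 : ℝ) ^ ((2 - θ) / (3 * θ)) * ⨆ p : Set.Ici (2 : ℝ), gammaTerm θ p := by
    positivity
  unfold constCLow
  rw [mul_assoc]
  have := Real.exp_pos 3
  gcongr
  nlinarith

theorem constCLow_pos {θ : ℝ} (hθ : 0 < θ) : 0 < constCLow θ :=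
  lt_of_lt_of_le (by positivity) (le_constCLow hθ)

theorem le_constCLow_mul_constA {θ : ℝ} (hθ : 0 < θ) :
    Real.exp 3 * 3 ^ ((2 - θ) / (3 * θ)) * (Real.exp 1 * θ) ^ (-(1 / θ)) ≤
      constCLow θ * constA θ := by
  have hC := constCLow_pos hθ
  rw [← div_le_iff₀' hC]
  refine le_ciInf fun p => ?_
  have hp : (2 : ℝ) ≤ p := p.2
  have := div_exp_rpow_le_gammaTerm hθ (by linarith : (0 : ℝ) < p)
  gcongr

theorem constC_mul_constB {θ : ℝ} (hθ : 1 < θ) :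
    constC θ * constB θ = 4 * Real.exp 1 * youngConst θ := by
  have h2 : 0 ≤ Real.log 2 ^ (1 / θ) := Real.rpow_nonneg (Real.log_nonneg (by norm_num)) _
  have h3 : 4 * Real.exp 1 + Real.log 2 ^ (1 / θ) ≠ 0 := by positivity
  rw [constC, if_neg (not_le.2 hθ), constB, youngConst]
  field_simp
  ring

theorem le_constC_of_one_lt {θ : ℝ} (hθ : 1 < θ) : 4 * Real.exp 1 ≤ constC θ := by
  have h2 : 0 ≤ Real.log 2 ^ (1 / θ) := Real.rpow_nonneg (Real.log_nonneg (by norm_num)) _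
  rw [constC, if_neg (not_le.2 hθ)]
  have := Real.exp_pos 1
  linarith

theorem constC_pos {θ : ℝ} (hθ : 0 < θ) : 0 < constC θ := by
  by_cases h : θ ≤ 1
  · rw [constC, if_pos h]
    exact constCLow_pos hθ
  · exact lt_of_lt_of_le (by positivity) (le_constC_of_one_lt (not_le.1 h))

theorem constL_pos {n : ℕ} {θ : ℝ} (hθ : 0 < θ) {b : Fin n → ℝ} (hb : b ≠ 0) :
    0 < constL θ b := by
  have hg : 0 < gam := by linarith [gam_mem.1]
  have hD := vecNorm_pos 2 hb
  have hC := constC_pos hθ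
  unfold constL
  split_ifs with h
  · have hA : 0 < constA θ := by
      refine pos_of_mul_pos_right ?_ (constCLow_pos hθ).le
      exact lt_of_lt_of_le (by positivity) (le_constCLow_mul_constA hθ)
    have : 0 < ‖b‖ := norm_pos_iff.2 hb
    positivity
  · have h' := not_le.1 h
    have hB : 0 < constB θ := by
      refine pos_of_mul_pos_right ?_ hC.le
      rw [constC_mul_constB h']
      have := youngConst_pos h'
      positivity
    have := vecNorm_pos (conj θ) hb
    positivity

/-! ### The tail estimate with the constants of the theorem -/

section Tail

variable {Ω : Type*} [MeasurableSpace Ω] {μ : Measure Ω} [IsProbabilityMeasure μ] {n : ℕ}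

/-- The two regimes are applied with `p = γ² y`. In the term `y^{1/θ}` the prefactor `γ` is surplus
and is dropped by `1 ≤ γ`. -/
theorem measureReal_abs_sum_ge_le {ξ : Fin n → Ω → ℝ} (hξ : ∀ i, Measurable (ξ i))
    (hind : iIndepFun ξ μ) (hmean : ∀ i, ∫ ω, ξ i ω ∂μ = 0) {θ y : ℝ} {b : Fin n → ℝ}
    (hθ : 0 < θ) (hy : 2 ≤ gam ^ 2 * y) (hb : b ≠ 0)
    (hint : ∀ i, Integrable (fun ω => Real.exp (|ξ i ω| ^ θ)) μ)
    (hE : ∀ i, ∫ ω, Real.exp (|ξ i ω| ^ θ) ∂μ ≤ 2) :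
    μ.real {ω | gam * Real.exp 1 * constC θ * vecNorm 2 b * (√y + constL θ b * y ^ (1 / θ)) ≤
      |∑ i, b i * ξ i ω|} ≤ Real.exp (-(gam ^ 2 * y)) := by
  have hg1 := gam_mem.1
  have hg : 0 < gam := by linarith
  have hy0 : 0 < y := by
    by_contra hcon
    push Not at hcon
    have : gam ^ 2 * y ≤ 0 := mul_nonpos_of_nonneg_of_nonpos (by positivity) hcon
    linarith
  have hD := vecNorm_pos 2 hb
  have hC := constC_pos hθ
  have hsq : √(gam ^ 2 * y) = gam * √y := by
    rw [Real.sqrt_mul (by positivity), Real.sqrt_sq hg.le]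
  have hrp : (gam ^ 2 * y) ^ (1 / θ) = gam ^ (2 / θ) * y ^ (1 / θ) := by
    rw [Real.mul_rpow (by positivity) hy0.le, ← Real.rpow_natCast_mul hg.le]
    congr 2
    push_cast
    ring
  have hpos := constL_pos hθ hb
  by_cases h : θ ≤ 1
  · refine measureReal_abs_sum_ge_le_of_le_one hξ hind hmean hθ h hy hint hE (by positivity) ?_
    have hCl := le_constCLow hθ
    have hA := le_constCLow_mul_constA hθ
    have e4 : Real.exp 4 = Real.exp 1 * Real.exp 3 := by rw [← Real.exp_add]; norm_num
    have eL : constL θ b = gam ^ (2 / θ) * constA θ * (‖b‖ / vecNorm 2 b) := if_pos h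
    have eC : constC θ = constCLow θ := if_pos h
    rw [hsq, hrp, eL, eC, e4, mul_add]
    apply add_le_add
    · calc _ = gam * Real.exp 1 * (2 * Real.exp 3 * (2 / (Real.exp 1 * θ)) ^ (1 / θ)) *
            vecNorm 2 b * √y := by ring
        _ ≤ gam * Real.exp 1 * constCLow θ * vecNorm 2 b * √y := by gcongr
        _ = _ := by ring
    · calc _ = 1 * Real.exp 1 * (Real.exp 3 * 3 ^ ((2 - θ) / (3 * θ)) *
            (Real.exp 1 * θ) ^ (-(1 / θ))) * ‖b‖ * (gam ^ (2 / θ) * y ^ (1 / θ)) := by ring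
        _ ≤ gam * Real.exp 1 * (constCLow θ * constA θ) * ‖b‖ *
            (gam ^ (2 / θ) * y ^ (1 / θ)) := by gcongr
        _ = _ := by field_simp
  · have h' := not_le.1 h
    refine measureReal_abs_sum_ge_le_of_one_lt hξ hind hmean h' hy hb hint hE ?_
    have hCB := constC_mul_constB h'
    have hCl := le_constC_of_one_lt h'
    have hκ := youngConst_pos h'
    have hN := vecNorm_pos (conj θ) hb
    have eL : constL θ b = gam ^ (2 / θ) * constB θ * (vecNorm (conj θ) b / vecNorm 2 b) :=
      if_neg h
    rw [hsq, hrp, eL, mul_add]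
    apply add_le_add
    · calc _ = gam * Real.exp 1 * (4 * Real.exp 1) * vecNorm 2 b * √y := by ring
        _ ≤ gam * Real.exp 1 * constC θ * vecNorm 2 b * √y := by gcongr
    · calc _ = 1 * Real.exp 1 * (4 * Real.exp 1 * youngConst θ) * vecNorm (conj θ) b *
            (gam ^ (2 / θ) * y ^ (1 / θ)) := by ring
        _ ≤ gam * Real.exp 1 * (4 * Real.exp 1 * youngConst θ) * vecNorm (conj θ) b *
            (gam ^ (2 / θ) * y ^ (1 / θ)) := by gcongr
        _ = gam * Real.exp 1 * (constC θ * constB θ) * vecNorm (conj θ) b *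
            (gam ^ (2 / θ) * y ^ (1 / θ)) := by rw [hCB]
        _ = _ := by field_simp

end Tail

/-! ### The function Ψ, the integral condition on γ, and the crossover of the two rates -/

theorem gboInv_strictMonoOn {θ L : ℝ} (hθ : 0 < θ) (hL : 0 ≤ L) :
    StrictMonoOn (gboInv θ L) (Set.Ici 0) := by
  intro s hs t ht hst
  have hs' : (0 : ℝ) ≤ s := hs
  have h0 : 0 ≤ Real.log (s + 1) := Real.log_nonneg (by linarith)
  have hlt : Real.log (s + 1) < Real.log (t + 1) := Real.log_lt_log (by linarith) (by linarith)
  have h1 : √(Real.log (s + 1)) < √(Real.log (t + 1)) := Real.sqrt_lt_sqrt h0 hlt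
  have h2 : L * Real.log (s + 1) ^ (1 / θ) ≤ L * Real.log (t + 1) ^ (1 / θ) := by gcongr
  simp only [gboInv]
  linarith

theorem gboFun_nonneg {θ L x : ℝ} (hθ : 0 < θ) (hL : 0 ≤ L) (hx : 0 ≤ x) : 0 ≤ gboFun θ L x :=
  (gboInv_bijOn hθ hL).surjOn.mapsTo_invFunOn hx

theorem le_gboFun_iff {θ L t x : ℝ} (hθ : 0 < θ) (hL : 0 ≤ L) (ht : 0 ≤ t) (hx : 0 ≤ x) :
    t ≤ gboFun θ L x ↔ gboInv θ L t ≤ x := by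
  have h := (gboInv_strictMonoOn hθ hL).le_iff_le (a := t) (b := gboFun θ L x) ht
    (gboFun_nonneg hθ hL hx)
  rw [(gboFun_invOn hθ hL).2 hx] at h
  exact h.symm

theorem gboFun_zero {θ L : ℝ} (hθ : 0 < θ) (hL : 0 ≤ L) : gboFun θ L 0 = 0 := by
  have h0 : gboInv θ L 0 = 0 := by simp [gboInv, hθ.ne']
  have := (gboFun_invOn hθ hL).1 (Set.mem_Ici.2 (le_refl (0 : ℝ)))
  rwa [h0] at this

theorem measurable_gboFun_comp {Ω : Type*} [MeasurableSpace Ω] {θ L : ℝ} (hθ : 0 < θ)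
    (hL : 0 ≤ L) {f : Ω → ℝ} (hf : Measurable f) (hf0 : ∀ ω, 0 ≤ f ω) :
    Measurable fun ω => gboFun θ L (f ω) := by
  -- Nothing is known about `gboFun` at negative arguments, so monotonicity is stated after clamping
  -- at 0.
  have hmono : Monotone fun x => gboFun θ L (max x 0) := by
    intro x y hxy
    have hx : 0 ≤ max x 0 := le_max_right _ _
    have hy : 0 ≤ max y 0 := le_max_right _ _
    refine (le_gboFun_iff hθ hL (gboFun_nonneg hθ hL hx) hy).2 ?_
    rw [(gboFun_invOn hθ hL).2 hx]
    exact max_le_max_right 0 hxy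
  have h := hmono.measurable.comp hf
  simpa only [Function.comp_def, max_eq_left (hf0 _)] using h

/-- The defining inequality of `gam`, in integrated form. -/
theorem lintegral_gam_tail_le :
    ENNReal.ofReal (Real.exp (2 / gam ^ 2) - 1) +
      ∫⁻ t in Set.Ioi (Real.exp (2 / gam ^ 2) - 1), ENNReal.ofReal ((t + 1) ^ (-gam ^ 2)) ≤ 1 := by
  obtain ⟨hg, h⟩ := gam_mem
  have hg2 : 0 < gam ^ 2 - 1 := by nlinarith
  have hgp : 0 < gam ^ 2 := by positivity
  set u := Real.exp (2 / gam ^ 2) with hu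
  have hu0 : 0 < u := Real.exp_pos _
  have hu1 : 1 ≤ u := Real.one_le_exp (by positivity)
  have h1 : ∫⁻ t in Set.Ioi (u - 1), ENNReal.ofReal ((t + 1) ^ (-gam ^ 2)) =
      ∫⁻ t in Set.Ioi u, ENNReal.ofReal (t ^ (-gam ^ 2)) := by
    have hpre : (fun t : ℝ => t + 1) ⁻¹' Set.Ioi u = Set.Ioi (u - 1) := by
      ext t
      simp [sub_lt_iff_lt_add]
    have hm : Measurable fun t : ℝ => ENNReal.ofReal (t ^ (-gam ^ 2)) := by fun_prop
    rw [← hpre]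
    exact (measurePreserving_add_right (volume : Measure ℝ) 1).setLIntegral_comp_preimage
      measurableSet_Ioi hm
  have h2 : ∫⁻ t in Set.Ioi u, ENNReal.ofReal (t ^ (-gam ^ 2)) =
      ENNReal.ofReal (u ^ (1 - gam ^ 2) / (gam ^ 2 - 1)) := by
    have ha : -gam ^ 2 < -1 := by linarith
    rw [← ofReal_integral_eq_lintegral_ofReal (integrableOn_Ioi_rpow_of_lt ha hu0) ?_,
      integral_Ioi_rpow_of_lt ha hu0]
    · congr 1
      rw [show -gam ^ 2 + 1 = -(gam ^ 2 - 1) by ring, neg_div_neg_eq, neg_sub]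
    · filter_upwards [ae_restrict_mem measurableSet_Ioi] with t ht
      exact Real.rpow_nonneg (hu0.trans ht).le _
  have h3 : u ^ (1 - gam ^ 2) = Real.exp (2 * (1 - gam ^ 2) / gam ^ 2) := by
    rw [hu, ← Real.exp_mul]
    congr 1
    field_simp
  rw [h1, h2, h3, ← ENNReal.ofReal_add (by linarith) (by positivity)]
  exact ENNReal.ofReal_le_one.2 h

/-- The case distinction between the two terms of the minimum. -/
theorem sq_le_div_rpow_iff {θ x L : ℝ} (hx : 0 < x) (hL : 0 < L) :
    x ^ 2 ≤ (x / L) ^ θ ↔ (2 - θ) * Real.log x ≤ -(θ * Real.log L) := by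
  rw [← Real.log_le_log_iff (by positivity) (by positivity), Real.log_rpow (by positivity),
    Real.log_pow, Real.log_div hx.ne' hL.ne']
  push_cast
  constructor <;> intro h <;> linarith

/-- In logarithms the comparison is linear in `log x` with slope `2 - θ`. The sign of the slope
decides on which side of the crossover the quadratic rate is the smaller one. -/
theorem le_rpow_iff_of_lt_two {θ x L : ℝ} (hθ2 : θ < 2) (hx : 0 < x) (hL : 0 < L) :
    x ≤ L ^ (θ / (θ - 2)) ↔ x ^ 2 ≤ (x / L) ^ θ := by
  rw [sq_le_div_rpow_iff hx hL, ← Real.log_le_log_iff hx (by positivity),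
    Real.log_rpow hL, show θ / (θ - 2) * Real.log L = -(θ * Real.log L) / (2 - θ) by
      rw [← neg_sub 2 θ, div_neg]; ring, le_div_iff₀ (by linarith), mul_comm]

theorem rpow_le_iff_of_two_lt {θ x L : ℝ} (hθ2 : 2 < θ) (hx : 0 < x) (hL : 0 < L) :
    L ^ (θ / (θ - 2)) ≤ x ↔ x ^ 2 ≤ (x / L) ^ θ := by
  rw [sq_le_div_rpow_iff hx hL, ← Real.log_le_log_iff (by positivity) hx,
    Real.log_rpow hL, div_mul_eq_mul_div, div_le_iff₀ (by linarith)]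
  constructor <;> intro h <;> linarith

theorem exp_neg_min_eq_ite {θ x L : ℝ} (hθ : 0 < θ) (hθ2 : θ ≠ 2) (hx : 0 ≤ x) (hL : 0 < L) :
    2 * Real.exp (-min ((x / L) ^ θ) (x ^ 2)) =
      if θ < 2 then
        if x ≤ L ^ (θ / (θ - 2)) then 2 * Real.exp (-x ^ 2)
        else 2 * Real.exp (-(x / L) ^ θ)
      else
        if x < L ^ (θ / (θ - 2)) then 2 * Real.exp (-(x / L) ^ θ)
        else 2 * Real.exp (-x ^ 2) := by
  rcases hx.eq_or_lt with rfl | hx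
  · simp [hθ.ne']
  split_ifs with h1 h2 h2
  · rw [min_eq_right ((le_rpow_iff_of_lt_two h1 hx hL).1 h2)]
  · rw [le_rpow_iff_of_lt_two h1 hx hL, not_le] at h2
    rw [min_eq_left h2.le]
  · rw [← not_le, rpow_le_iff_of_two_lt (lt_of_le_of_ne (not_lt.1 h1) hθ2.symm) hx hL,
      not_le] at h2
    rw [min_eq_left h2.le]
  · rw [not_lt, rpow_le_iff_of_two_lt (lt_of_le_of_ne (not_lt.1 h1) hθ2.symm) hx hL] at h2
    rw [min_eq_right h2]

/-! ### From tails to the Bernstein-Orlicz norm and back -/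

section Orlicz

variable {Ω : Type*} [MeasurableSpace Ω] {μ : Measure Ω} [IsProbabilityMeasure μ]

/-- A Gaussian-Weibull tail with rate `gam ^ 2` gives a generalized Bernstein-Orlicz norm. -/
theorem lintegral_gboFun_le_one {Y : Ω → ℝ} (hY : Measurable Y) {θ L K : ℝ} (hθ : 0 < θ)
    (hL : 0 ≤ L) (hK : 0 < K)
    (h : ∀ y, 2 ≤ gam ^ 2 * y →
      μ.real {ω | K * (√y + L * y ^ (1 / θ)) ≤ |Y ω|} ≤ Real.exp (-(gam ^ 2 * y))) :
    ∫⁻ ω, ENNReal.ofReal (gboFun θ L (|Y ω| / K)) ∂μ ≤ 1 := by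
  have hg : 0 < gam ^ 2 := by
    have := gam_mem.1
    positivity
  have h0 : ∀ ω, 0 ≤ |Y ω| / K := fun ω => by positivity
  have hu : 0 ≤ Real.exp (2 / gam ^ 2) - 1 := by
    have := Real.one_le_exp (x := 2 / gam ^ 2) (by positivity)
    linarith
  rw [lintegral_eq_lintegral_meas_le μ
    (Filter.Eventually.of_forall fun ω => gboFun_nonneg hθ hL (h0 ω))
    (measurable_gboFun_comp hθ hL (by fun_prop) h0).aemeasurable,
    ← Set.Ioc_union_Ioi_eq_Ioi hu]
  -- The split point is where `γ² log(t+1) = 2`: the tail estimate is available only beyond it, and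
  -- there it reads `(t+1)^{-γ²}`.
  refine (lintegral_union_le _ _ _).trans (le_trans (add_le_add ?_ ?_) lintegral_gam_tail_le)
  · calc _ ≤ ∫⁻ _ in Set.Ioc 0 (Real.exp (2 / gam ^ 2) - 1), (1 : ℝ≥0∞) :=
          lintegral_mono fun t => prob_le_one
      _ = _ := by simp
  · refine setLIntegral_mono (by fun_prop) fun t ht => ?_
    have ht' : Real.exp (2 / gam ^ 2) - 1 < t := ht
    have ht0 : 0 ≤ t := hu.trans ht'.le
    have hlog : 2 ≤ gam ^ 2 * Real.log (t + 1) := by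
      rw [← div_le_iff₀' hg, Real.le_log_iff_exp_le (by linarith)]
      linarith
    have e : {ω | t ≤ gboFun θ L (|Y ω| / K)} =
        {ω | K * (√(Real.log (t + 1)) + L * Real.log (t + 1) ^ (1 / θ)) ≤ |Y ω|} := by
      ext ω
      simp only [Set.mem_ofPred_eq]
      rw [le_gboFun_iff hθ hL ht0 (h0 ω), le_div_iff₀' hK, gboInv]
    rw [e, ← ofReal_measureReal (measure_ne_top _ _)]
    apply ENNReal.ofReal_le_ofReal
    refine (h _ hlog).trans_eq ?_
    rw [Real.rpow_def_of_pos (by linarith)]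
    ring_nf

/-- Markov's inequality for the generalized Bernstein-Orlicz norm. -/
theorem measureReal_ge_le_of_lintegral_gboFun_le_one {Y : Ω → ℝ} (hY : Measurable Y)
    {θ L K : ℝ} (hθ : 0 < θ) (hL : 0 ≤ L) (hK : 0 < K)
    (h : ∫⁻ ω, ENNReal.ofReal (gboFun θ L (|Y ω| / K)) ∂μ ≤ 1) {t : ℝ} (ht : 0 ≤ t) :
    μ.real {ω | K * (√t + L * t ^ (1 / θ)) ≤ |Y ω|} ≤ 2 * Real.exp (-t) := by
  have h0 : ∀ ω, 0 ≤ |Y ω| / K := fun ω => by positivity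
  have hm := measurable_gboFun_comp hθ hL (f := fun ω => |Y ω| / K) (by fun_prop) h0
  have het : 0 ≤ Real.exp t - 1 := by
    have := Real.one_le_exp ht
    linarith
  -- Markov is applied to `Ψ + 1`, of mean at most 2, at the level `e^t`; the level `e^t - 1` for
  -- `Ψ` pulls back to `√t + L t^{1/θ}`.
  have h1 := mul_meas_ge_le_lintegral (μ := μ)
    (f := fun ω => ENNReal.ofReal (gboFun θ L (|Y ω| / K)) + 1) (by fun_prop)
    (ENNReal.ofReal (Real.exp t))
  have h2 : ∫⁻ ω, (ENNReal.ofReal (gboFun θ L (|Y ω| / K)) + 1) ∂μ ≤ 2 := by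
    rw [lintegral_add_right _ measurable_const, lintegral_one, measure_univ, ← one_add_one_eq_two]
    gcongr
  have h3 : {ω | K * (√t + L * t ^ (1 / θ)) ≤ |Y ω|} ⊆
      {ω | ENNReal.ofReal (Real.exp t) ≤ ENNReal.ofReal (gboFun θ L (|Y ω| / K)) + 1} := by
    intro ω hω
    simp only [Set.mem_ofPred_eq] at hω ⊢
    rw [← ENNReal.ofReal_one, ← ENNReal.ofReal_add (gboFun_nonneg hθ hL (h0 ω)) one_pos.le]
    apply ENNReal.ofReal_le_ofReal
    rw [← sub_le_iff_le_add, le_gboFun_iff hθ hL het (h0 ω), le_div_iff₀' hK, gboInv,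
      sub_add_cancel, Real.log_exp]
    exact hω
  have h4 : ENNReal.ofReal (Real.exp t) * μ {ω | K * (√t + L * t ^ (1 / θ)) ≤ |Y ω|} ≤
      ENNReal.ofReal 2 := by
    rw [ENNReal.ofReal_ofNat]
    exact (mul_le_mul_right (measure_mono h3) _).trans (h1.trans h2)
  rw [← ofReal_measureReal (measure_ne_top _ _), ← ENNReal.ofReal_mul (Real.exp_nonneg _),
    ENNReal.ofReal_le_ofReal_iff (by norm_num)] at h4
  rw [Real.exp_neg, ← div_eq_mul_inv, le_div_iff₀' (Real.exp_pos _)]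
  exact h4

end Orlicz

/-! ### Upper bounds for the Bernstein-Orlicz norm -/

section Norm

variable {Ω : Type*} [MeasurableSpace Ω] {μ : Measure Ω}

theorem gboNorm_le_of_lintegral_le_one {Y : Ω → ℝ} {θ L K : ℝ} (hK : 0 < K)
    (h : ∫⁻ ω, ENNReal.ofReal (gboFun θ L (|Y ω| / K)) ∂μ ≤ 1) :
    gboNorm μ θ L Y ≤ ENNReal.ofReal K :=
  sInf_le ⟨K, ⟨hK, h⟩, rfl⟩

theorem gboNorm_eq_zero_of_ae_eq_zero {Y : Ω → ℝ} {θ L : ℝ} (hθ : 0 < θ) (hL : 0 ≤ L)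
    (h : ∀ᵐ ω ∂μ, Y ω = 0) : gboNorm μ θ L Y = 0 := by
  refine le_antisymm (ENNReal.le_of_forall_pos_le_add fun ε hε _ => ?_) (zero_le)
  rw [zero_add, ← ENNReal.ofReal_coe_nnreal]
  refine gboNorm_le_of_lintegral_le_one hε ?_
  have : ∫⁻ ω, ENNReal.ofReal (gboFun θ L (|Y ω| / ε)) ∂μ = ∫⁻ _, 0 ∂μ := by
    refine lintegral_congr_ae ?_
    filter_upwards [h] with ω hω
    simp [hω, gboFun_zero hθ hL]
  rw [this, lintegral_zero]
  exact zero_le_one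

end Norm

theorem constL_zero {n : ℕ} {θ : ℝ} : constL θ (0 : Fin n → ℝ) = 0 := by
  have h : vecNorm 2 (0 : Fin n → ℝ) = 0 := by simp [vecNorm]
  simp [constL, h]

end SubWeibull

/-! ### The theorem -/

theorem theorem1 {Ω : Type*} [MeasurableSpace Ω] (μ : Measure Ω) [IsProbabilityMeasure μ]
    (n : ℕ) (X : Fin n → Ω → ℝ) (θ : ℝ) (hθ : 0 < θ)
    (hmeas : ∀ i, Measurable (X i))
    (hindep : iIndepFun X μ)
    (hmean : ∀ i, ∫ ω, X i ω ∂μ = 0)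
    (hpsi : ∀ i, SubWeibull.psiNorm μ θ (X i) < ∞)
    (w : Fin n → ℝ) (b : Fin n → ℝ) (hb : b = SubWeibull.bVec μ θ w X)
    (C L : ℝ) (hC : C = SubWeibull.constC θ) (hL : L = SubWeibull.constL θ b) :
    -- (a)
    SubWeibull.gboNorm μ θ L (fun ω => ∑ i, w i * X i ω) ≤
        ENNReal.ofReal (SubWeibull.gam * Real.exp 1 * C * SubWeibull.vecNorm 2 b) ∧
    (b ≠ 0 →
      -- (b)
      (∀ t : ℝ, 0 ≤ t →
        μ.real {ω | 2 * Real.exp 1 * C * SubWeibull.vecNorm 2 b * (√t + L * t ^ (1 / θ)) ≤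
          |∑ i, w i * X i ω|} ≤ 2 * Real.exp (-t)) ∧
      -- (c)
      (θ ≠ 2 → ∀ s : ℝ, 0 ≤ s →
        μ.real {ω | s ≤ |∑ i, w i * X i ω|} ≤
            2 * Real.exp (-(min
              (s ^ θ / (4 * Real.exp 1 * C * SubWeibull.vecNorm 2 b * L) ^ θ)
              (s ^ 2 / (16 * Real.exp 1 ^ 2 * C ^ 2 * SubWeibull.vecNorm 2 b ^ 2)))) ∧
        2 * Real.exp (-(min
              (s ^ θ / (4 * Real.exp 1 * C * SubWeibull.vecNorm 2 b * L) ^ θ)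
              (s ^ 2 / (16 * Real.exp 1 ^ 2 * C ^ 2 * SubWeibull.vecNorm 2 b ^ 2)))) =
          if θ < 2 then
            if s ≤ 4 * Real.exp 1 * C * SubWeibull.vecNorm 2 b * L ^ (θ / (θ - 2)) then
              2 * Real.exp (-(s ^ 2 /
                (16 * Real.exp 1 ^ 2 * C ^ 2 * SubWeibull.vecNorm 2 b ^ 2)))
            else
              2 * Real.exp (-(s ^ θ /
                (4 * Real.exp 1 * C * SubWeibull.vecNorm 2 b * L) ^ θ))
          else
            if s < 4 * Real.exp 1 * C * SubWeibull.vecNorm 2 b * L ^ (θ / (θ - 2)) then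
              2 * Real.exp (-(s ^ θ /
                (4 * Real.exp 1 * C * SubWeibull.vecNorm 2 b * L) ^ θ))
            else
              2 * Real.exp (-(s ^ 2 /
                (16 * Real.exp 1 ^ 2 * C ^ 2 * SubWeibull.vecNorm 2 b ^ 2))))) := by
  set Y : Ω → ℝ := fun ω => ∑ i, w i * X i ω
  have hY : Measurable Y := by fun_prop
  set ξ : Fin n → Ω → ℝ := fun i => SubWeibull.normalized μ θ (X i)
  have hYξ : ∀ᵐ ω ∂μ, Y ω = ∑ i, b i * ξ i ω := by
    have h := ae_all_iff.2 fun i =>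
      SubWeibull.normalized_mul_psiNorm (μ := μ) hθ (hmeas i) (hpsi i)
    filter_upwards [h] with ω hω
    refine Finset.sum_congr rfl fun i _ => ?_
    rw [hb, SubWeibull.bVec, mul_assoc, hω i]
  by_cases hb0 : b = 0
  · refine ⟨?_, fun h => absurd hb0 h⟩
    have hY0 : ∀ᵐ ω ∂μ, Y ω = 0 := by
      filter_upwards [hYξ] with ω hω
      simp [hω, hb0]
    have hL0 : L = 0 := by rw [hL, hb0, SubWeibull.constL_zero]
    rw [SubWeibull.gboNorm_eq_zero_of_ae_eq_zero hθ hL0.ge hY0]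
    exact zero_le
  have hCpos : 0 < C := hC ▸ SubWeibull.constC_pos hθ
  have hLpos : 0 < L := hL ▸ SubWeibull.constL_pos hθ hb0
  have hD := SubWeibull.vecNorm_pos 2 hb0
  have hg1 := SubWeibull.gam_mem.1
  have hg : 0 < SubWeibull.gam := by linarith
  set D := SubWeibull.vecNorm 2 b with hDdef
  set K := SubWeibull.gam * Real.exp 1 * C * D with hK
  have hKpos : 0 < K := by positivity
  have htail : ∀ y, 2 ≤ SubWeibull.gam ^ 2 * y →
      μ.real {ω | K * (√y + L * y ^ (1 / θ)) ≤ |Y ω|} ≤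
        Real.exp (-(SubWeibull.gam ^ 2 * y)) := by
    intro y hy
    have hae : {ω | K * (√y + L * y ^ (1 / θ)) ≤ |Y ω|} =ᵐ[μ]
        {ω | K * (√y + L * y ^ (1 / θ)) ≤ |∑ i, b i * ξ i ω|} := by
      filter_upwards [hYξ] with ω hω
      exact congrArg (fun r => K * (√y + L * y ^ (1 / θ)) ≤ |r|) hω
    rw [measureReal_congr hae, hK, hC, hL]
    refine SubWeibull.measureReal_abs_sum_ge_le (fun i => (hmeas i).div_const _)
      (hindep.comp (fun i x => x / (SubWeibull.psiNorm μ θ (X i)).toReal)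
        fun i => measurable_id.div_const _) (fun i => ?_) hθ hy hb0
      (fun i => (SubWeibull.normalized_exp_moment hθ (hmeas i) (hpsi i)).1)
      (fun i => (SubWeibull.normalized_exp_moment hθ (hmeas i) (hpsi i)).2)
    simp only [integral_div, hmean i, zero_div]
  have hone := SubWeibull.lintegral_gboFun_le_one hY hθ hLpos.le hKpos htail
  have hbern : ∀ t : ℝ, 0 ≤ t →
      μ.real {ω | 2 * Real.exp 1 * C * D * (√t + L * t ^ (1 / θ)) ≤ |Y ω|} ≤
        2 * Real.exp (-t) := by
    intro t ht
    refine le_trans (measureReal_mono fun ω hω => ?_)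
      (SubWeibull.measureReal_ge_le_of_lintegral_gboFun_le_one hY hθ hLpos.le hKpos hone ht)
    -- Only here is `γ` rounded up to 2; part (a) keeps the sharper constant.
    refine le_trans ?_ (Set.mem_ofPred_eq.mp hω)
    have := SubWeibull.gam_le_two
    rw [hK]
    gcongr
  refine ⟨SubWeibull.gboNorm_le_of_lintegral_le_one hKpos hone, fun _ => ⟨hbern, ?_⟩⟩
  intro hθ2 s hs
  set x := s / (4 * Real.exp 1 * C * D) with hx
  have hx0 : 0 ≤ x := by positivity
  have e1 : s ^ θ / (4 * Real.exp 1 * C * D * L) ^ θ = (x / L) ^ θ := by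
    rw [← Real.div_rpow hs (by positivity), hx, div_div]
  have e2 : s ^ 2 / (16 * Real.exp 1 ^ 2 * C ^ 2 * D ^ 2) = x ^ 2 := by
    rw [hx, div_pow]
    ring
  have e3 : s ≤ 4 * Real.exp 1 * C * D * L ^ (θ / (θ - 2)) ↔ x ≤ L ^ (θ / (θ - 2)) := by
    rw [hx, div_le_iff₀' (by positivity)]
  have e4 : s < 4 * Real.exp 1 * C * D * L ^ (θ / (θ - 2)) ↔ x < L ^ (θ / (θ - 2)) := by
    rw [hx, div_lt_iff₀' (by positivity)]
  simp only [e1, e2, e3, e4]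
  refine ⟨?_, SubWeibull.exp_neg_min_eq_ite hθ hθ2 hx0 hLpos⟩
  -- With this `t`, `√t` and `L t^{1/θ}` are both at most `x`, so the threshold of (b) is at most
  -- `2eCD * 2x = s`.
  set t := min ((x / L) ^ θ) (x ^ 2) with ht
  have ht0 : 0 ≤ t := le_min (by positivity) (by positivity)
  refine le_trans (measureReal_mono fun ω hω => ?_) (hbern t ht0)
  refine le_trans ?_ (Set.mem_ofPred_eq.mp hω)
  have h1 : √t ≤ x := Real.sqrt_le_iff.2 ⟨hx0, min_le_right _ _⟩
  have h2 : L * t ^ (1 / θ) ≤ x := by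
    have h3 : t ^ (1 / θ) ≤ x / L := by
      calc t ^ (1 / θ) ≤ ((x / L) ^ θ) ^ (1 / θ) :=
            Real.rpow_le_rpow ht0 (min_le_left _ _) (by positivity)
        _ = x / L := by
            rw [← Real.rpow_mul (by positivity), mul_one_div_cancel hθ.ne', Real.rpow_one]
    rwa [le_div_iff₀' hLpos] at h3
  calc 2 * Real.exp 1 * C * D * (√t + L * t ^ (1 / θ)) ≤ 2 * Real.exp 1 * C * D * (x + x) := by
        gcongr
    _ = s := by
        rw [hx]
        field_simp
        ring
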